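/- Let $m,n\ge 0$ and $p\ge 1$ be integers, let $M\in\mathbb R$, $\beta>0$, $h_0>0$, and write, for such $M,\beta$, $$W_{M,\beta}=\{x\in\mathbb C:\ \operatorname{Re}x\ge M,\ |\operatorname{Im}x|\le\beta(\operatorname{Re}x-M)\}.$$ For $0<h\le h_0$ let $A_{11}(x,h)\in\mathbb C^{m\times m}$, $A_{22}(x,h)\in\mathbb C^{n\times n}$ and $\Theta(x,h)\in\mathbb C^{(m+n)\times(m+n)}$ be analytic in $x$ on (a neighborhood of) $W_{M,\beta}$, and suppose that there are matrices $A_{jj}(+\infty,h)$, $0\le h\le h_0$, and constants $C,\eta>0$ such that $$|A_{jj}(x,h)-A_{jj}(+\infty,h)|\le Ce^{-\eta\operatorname{Re}x},\qquad |\Theta(x,h)|\le C\qquad (x\in W_{M,\beta},\ 0<h\le h_0,\ j=1,2).$$ Suppose further that $A_{jj}(+\infty,h)\to A_{jj}(+\infty,0)$ as $h\to0^+$, and that $A_{11}(+\infty,0)$ and $A_{22}(+\infty,0)$ have no eigenvalue in common. Then there are $M'\ge M$, $0<\beta'\le\beta$, $0<h_1\le h_0$ and matrices $T(x,h)\in\mathbb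 C^{(m+n)\times(m+n)}$, for $x$ in a neighborhood of $W_{M',\beta'}$ (possibly depending on $h$) and $0<h\le h_1$, such that: 1. For each $h$, $T(\cdot,h)$ is analytic on (a neighborhood of) $W_{M',\beta'}$ with invertible values on $W_{M',\beta'}$, and $W=TZ$ transforms the system $$hW'=\begin{pmatrix}A_{11}&0\\0&A_{22}\end{pmatrix}W+h^p\,\Theta W$$ on $W_{M',\beta'}$ into a block-diagonal system $hZ'=\begin{pmatrix}D_1&0\\0&D_2\end{pmatrix}Z$ with $D_1(\cdot,h)\in\mathbb C^{m\times m}$ and $D_2(\cdot,h)\in\mathbb C^{n\times n}$ analytic; that is, $hT'+T\,\mathrm{diag}(D_1,D_2)=(\mathrm{diag}(A_{11},A_{22})+h^p\Theta)T$ there. 2. $T$ is bounded on $W_{M',\beta'}$ uniformly in $0<h\le h_1$, and $|T-\mathrm{Id}|\le C'h^p$ on $W_{M',\beta'}$ for $0<h\le h_1$, with $C'$ independent of $x$ and $h$. 3. If $\Theta$ is uniformly exponentially convergent, i.e. $|\Theta(x,h)-\Theta(+\infty,h)|\le C_1e^{-\eta_1\operatorname{Re}x}$ on $W_{M,\beta}$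 for all $0<h\le h_0$, for some matrices $\Theta(+\infty,h)$ and constants $C_1$ and $\eta_1>0$, then so is $T$: $|T(x,h)-T(+\infty,h)|\le C_2e^{-\eta_2\operatorname{Re}x}$ on $W_{M',\beta'}$ for all $0<h\le h_1$, for some matrices $T(+\infty,h)$ and constants $C_2$ and $\eta_2>0$. 4. If $|\Theta(x,h)|\le C_1e^{-\eta_1\operatorname{Re}x}$ on $W_{M,\beta}$ for all $0<h\le h_0$, for some constants $C_1$ and $\eta_1>0$, then $|T(x,h)-\mathrm{Id}|\le C_2e^{-\eta_2\operatorname{Re}x}$ on $W_{M',\beta'}$ for all $0<h\le h_1$, for some constants $C_2$ and $\eta_2>0$. -/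

import Mathlib

open Set Filter Topology

-- Matrices carry the operator norm induced by the sup norm on vectors; since dimensions are fixed,
-- the choice of matrix norm is immaterial for the bounds below.
attribute [local instance] Matrix.linftyOpNormedAddCommGroup Matrix.linftyOpNormedSpace
attribute [local instance] Matrix.linftyOpNormedRing Matrix.linftyOpNormedAlgebra

namespace BlockDiag

/-- The closed wedge around `+∞` with vertex `M` on the real axis and slope `β`:
`Re x ≥ M` and `|Im x| ≤ β (Re x - M)`. -/
def wedge (M β : ℝ) : Set ℂ := {x | M ≤ x.re ∧ |x.im| ≤ β * (x.re - M)}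

/-- `F h x` converges exponentially to `L h` as `Re x → ∞` in `S`, uniformly for `0 < h ≤ h₀`. -/
def UniformExpConv {E : Type*} [NormedAddCommGroup E] (h₀ : ℝ) (S : Set ℂ)
    (F : ℝ → ℂ → E) (L : ℝ → E) : Prop :=
  ∃ C η : ℝ, 0 < η ∧ ∀ h ∈ Ioc 0 h₀, ∀ x ∈ S, ‖F h x - L h‖ ≤ C * Real.exp (-η * x.re)

/-- `F h x` is bounded for `x ∈ S`, uniformly for `0 < h ≤ h₀`. -/
def UniformBdd {E : Type*} [NormedAddCommGroup E] (h₀ : ℝ) (S : Set ℂ)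
    (F : ℝ → ℂ → E) : Prop :=
  ∃ C : ℝ, ∀ h ∈ Ioc 0 h₀, ∀ x ∈ S, ‖F h x‖ ≤ C

/-- The coefficient `diag(A₁₁, A₂₂) + h ^ p Θ` of the system
`h W' = diag(A₁₁, A₂₂) W + h ^ p Θ W`. -/
def coeff {m n : ℕ} (p : ℕ)
    (A₁₁ : ℝ → ℂ → Matrix (Fin m) (Fin m) ℂ) (A₂₂ : ℝ → ℂ → Matrix (Fin n) (Fin n) ℂ)
    (Θ : ℝ → ℂ → Matrix (Fin m ⊕ Fin n) (Fin m ⊕ Fin n) ℂ) (h : ℝ) (x : ℂ) :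
    Matrix (Fin m ⊕ Fin n) (Fin m ⊕ Fin n) ℂ :=
  Matrix.fromBlocks (A₁₁ h x) 0 0 (A₂₂ h x) + ((h : ℂ) ^ p) • Θ h x

/-- `T` is an analytic block-diagonalizing conjugator on `S` of `h W' = G(x) W`: it is analytic with
invertible values, and the change of coordinates `W = T Z` transforms the system into
`h Z' = diag(D₁, D₂) Z` with `D₁`, `D₂` analytic. Substituting `W = T Z` and cancelling `Z`,
the latter means `h T' + T diag(D₁, D₂) = G T`. -/
def IsBlockDiagConjugator {m n : ℕ} (h : ℝ) (S : Set ℂ)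
    (G T : ℂ → Matrix (Fin m ⊕ Fin n) (Fin m ⊕ Fin n) ℂ) : Prop :=
  AnalyticOnNhd ℂ T S ∧ (∀ x ∈ S, IsUnit (T x)) ∧
    ∃ (D₁ : ℂ → Matrix (Fin m) (Fin m) ℂ) (D₂ : ℂ → Matrix (Fin n) (Fin n) ℂ),
      AnalyticOnNhd ℂ D₁ S ∧ AnalyticOnNhd ℂ D₂ S ∧
        ∀ x ∈ S, (h : ℂ) • deriv T x + T x * Matrix.fromBlocks (D₁ x) 0 0 (D₂ x) = G x * T x

end BlockDiag

namespace BlockDiag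

/-! Seek `T` with identity diagonal blocks and off-diagonal blocks `s X`, `s Y`, where `s = h ^ p`.
The diagonal blocks of `h T' + T D = G T` define `D₁`, `D₂`; the off-diagonal ones decouple into two
Riccati equations, `h Y' = A₂₂ Y - Y A₁₁ + Θ₂₁ + s (Θ₂₂ Y - Y Θ₁₁) - s² Y Θ₁₂ Y` and its mirror
image for `X`. Holomorphic solutions bounded uniformly in `h` on a smaller wedge are enough: `T - 1`
is then `O(h ^ p)`, and `T` is invertible for small `h`.

In the limit (`x = +∞`, `h = 0`) the Sylvester operator `Y ↦ A₂₂ Y - Y A₁₁` has eigenvalues `l = d₂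
i - d₁ j`, nonzero by the spectral hypothesis. Similarities make both limits nearly diagonal
(`exists_similar_near_diagonal`), so the equation is entrywise multiplication by `l` plus a
perturbation of small Lipschitz constant. The scalar equation `h u' = l u + f` has a solution
operator bounded in sup norm uniformly in `h` (`exists_scalar_solution_operator`): Duhamel's formula
from the vertex if `Re l < 0`, on a wedge narrow enough for the kernel to decay along every ray, and
from infinity otherwise. Imaginary `l` is no obstacle, since the ray to infinity can be tilted
inside the wedge. A contraction on bounded holomorphic functions finishes
(`exists_holomorphic_fixedPoint`).

For exponential convergence, take an equilibrium `a` of the limiting Riccati equation and put `y = a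
+ exp(-η x) v`; the equation for `v` has the same form with the small extra term `h η v`
(`exists_convergent_solution`). The rate `η = 0` covers mere boundedness, and `Θ → 0` forces `a =
0`, hence `T → 1`. -/

/-! ### Similarity to nearly diagonal matrices -/

/-- Triangularize by induction on an invariant hyperplane and shrink the off-diagonal entries by
rescaling basis vectors. It matters that `d` precedes `ε`: later `ε` is chosen from constants that
depend on `d`. -/
theorem exists_basis_near_diagonal (n : ℕ) : ∀ {V : Type} [AddCommGroup V] [Module ℂ V]
    [FiniteDimensional ℂ V] (f : Module.End ℂ V), Module.finrank ℂ V = n →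
    ∃ d : Fin n → ℂ, (∀ i, f.HasEigenvalue (d i)) ∧ ∀ ε : ℝ, 0 < ε →
      ∃ (b : Module.Basis (Fin n) ℂ V) (c : Fin n → Fin n → ℂ), (∀ i j, ‖c i j‖ ≤ ε) ∧
        ∀ j, f (b j) = d j • b j + ∑ i, c i j • b i := by
  induction n with
  | zero =>
    intro V _ _ _ f hV
    refine ⟨Fin.elim0, fun i => i.elim0, fun ε _ => ⟨Module.finBasisOfFinrankEq ℂ V hV,
      fun i => i.elim0, fun i => i.elim0, fun i => i.elim0⟩⟩
  | succ n ih =>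
    intro V _ _ _ f hV
    have : Nontrivial V := Module.nontrivial_of_finrank_pos (R := ℂ) (by omega)
    obtain ⟨μ, hμ⟩ := Module.End.exists_eigenvalue f
    -- As `μ` is an eigenvalue, `f - μ` is not surjective; its range lies in some hyperplane `ker
    -- φ`, so `φ ∘ f = μ φ` and the hyperplane is invariant.
    have hlt : LinearMap.range (f - algebraMap ℂ (Module.End ℂ V) μ) < ⊤ := by
      rw [lt_top_iff_ne_top]
      intro h
      have h1 := LinearMap.injective_iff_surjective.2 (LinearMap.range_eq_top.1 h)
      obtain ⟨v, hv⟩ := hμ.exists_hasEigenvector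
      refine hv.2 (h1 ?_)
      simp [Module.algebraMap_end_apply, hv.apply_eq_smul]
    obtain ⟨φ, hφ, hle⟩ := Submodule.exists_le_ker_of_lt_top _ hlt
    have hfφ : ∀ x, φ (f x) = μ * φ x := by
      intro x
      have := hle (LinearMap.mem_range_self _ x)
      simp only [LinearMap.mem_ker, LinearMap.sub_apply, map_sub, Module.algebraMap_end_apply,
        map_smul, smul_eq_mul] at this
      linear_combination this
    have hinv : ∀ x ∈ LinearMap.ker φ, f x ∈ LinearMap.ker φ := by
      intro x hx
      rw [LinearMap.mem_ker] at hx ⊢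
      rw [hfφ, hx, mul_zero]
    obtain ⟨d, hd, hdε⟩ := ih (f.restrict hinv) (by
      have := Module.Dual.finrank_ker_add_one_of_ne_zero hφ
      omega)
    obtain ⟨v, hv⟩ : ∃ v, φ v = 1 := by
      obtain ⟨w, hw⟩ : ∃ w, φ w ≠ 0 := by
        by_contra! h
        exact hφ (LinearMap.ext h)
      exact ⟨(φ w)⁻¹ • w, by simp [hw]⟩
    refine ⟨Fin.cons μ d, ?_, ?_⟩
    · intro i
      refine Fin.cases hμ (fun i => ?_) i
      obtain ⟨w, hw⟩ := (hd i).exists_hasEigenvector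
      refine Module.End.hasEigenvalue_of_hasEigenvector (x := (w : V)) ⟨?_, ?_⟩
      · rw [Module.End.mem_eigenspace_iff]
        exact congrArg Subtype.val hw.apply_eq_smul
      · exact fun h => hw.2 (Subtype.ext h)
    · intro ε hε
      obtain ⟨b, c, hc, hb⟩ := hdε ε hε
      have hw : f v - μ • v ∈ LinearMap.ker φ := by simp [hfφ]
      set w : LinearMap.ker φ := ⟨f v - μ • v, hw⟩ with hwdef
      -- The new basis vector is `t v`, so the coordinates of `f (t v) - μ t v` in `b` are scaled by
      -- `t`; the `+ 1` keeps the denominator positive.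
      set t : ℝ := ε / (∑ i, ‖b.repr w i‖ + 1) with ht
      have hS : 0 < ∑ i, ‖b.repr w i‖ + 1 := by positivity
      have htpos : 0 < t := by positivity
      have ht0 : (t : ℂ) ≠ 0 := by exact_mod_cast htpos.ne'
      let B : Module.Basis (Fin (n + 1)) ℂ V := Module.Basis.mkFinCons ((t : ℂ) • v) b
        (by
          intro a x hx h
          have := congrArg φ h
          rw [LinearMap.mem_ker] at hx
          simpa [hx, hv, ht0] using this)
        (by
          intro z
          refine ⟨-(φ z / t), ?_⟩
          simp [hv, ht0])
      have hB0 : B 0 = (t : ℂ) • v := by simp [B, Module.Basis.coe_mkFinCons]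
      have hBs : ∀ i : Fin n, B i.succ = b i := by
        intro i
        simp [B, Module.Basis.coe_mkFinCons]
      refine ⟨B, fun i j => Fin.cases (motive := fun _ => ℂ) 0 (fun i => Fin.cases
        (motive := fun _ => ℂ) (t * b.repr w i) (fun j => c i j) j) i, ?_, ?_⟩
      · intro i j
        refine Fin.cases (by simpa using hε.le) (fun i => ?_) i
        refine Fin.cases ?_ (fun j => ?_) j
        · simp only [Fin.cases_succ, Fin.cases_zero, norm_mul, Complex.norm_real, Real.norm_eq_abs,
            abs_of_pos htpos]
          have : ‖b.repr w i‖ ≤ ∑ i, ‖b.repr w i‖ + 1 :=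
            (Finset.single_le_sum (f := fun i => ‖b.repr w i‖) (fun _ _ => norm_nonneg _)
              (Finset.mem_univ i)).trans (by linarith)
          rw [ht, div_mul_eq_mul_div, div_le_iff₀ hS]
          gcongr
        · simpa using hc i j
      · intro j
        rw [Fin.sum_univ_succ]
        refine Fin.cases ?_ (fun j => ?_) j
        · simp only [Fin.cases_zero, Fin.cases_succ, hB0, hBs, Fin.cons_zero, map_smul]
          have h1 : f v = μ • v + ∑ i, b.repr w i • (b i : V) := by
            have := congrArg Subtype.val (b.sum_repr w)
            simp only [AddSubmonoidClass.coe_finsetSum, Submodule.coe_smul] at this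
            rw [this, hwdef]
            simp
          rw [h1]
          simp only [smul_add, Finset.smul_sum, smul_smul, mul_comm _ (t : ℂ), mul_zero, zero_smul,
            zero_add]
        · have := congrArg Subtype.val (hb j)
          simp only [LinearMap.coe_restrict_apply, Submodule.coe_add, Submodule.coe_smul,
            AddSubmonoidClass.coe_finsetSum] at this
          simp [hBs, this]

theorem norm_le_of_entry_le {m n : ℕ} {A : Matrix (Fin m) (Fin n) ℂ} {r : ℝ} (hr : 0 ≤ r)
    (h : ∀ i j, ‖A i j‖ ≤ r) : ‖A‖ ≤ n * r := by
  lift r to NNReal using hr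
  rw [← coe_nnnorm, Matrix.linfty_opNNNorm_def]
  norm_cast
  refine Finset.sup_le fun i _ => ?_
  refine (Finset.sum_le_card_nsmul _ _ r fun j _ => by exact_mod_cast h i j).trans ?_
  simp

/-- Every complex matrix is similar to a matrix arbitrarily close to a fixed diagonal matrix with
entries in its spectrum. -/
theorem exists_similar_near_diagonal {n : ℕ} (A : Matrix (Fin n) (Fin n) ℂ) :
    ∃ d : Fin n → ℂ, (∀ i, d i ∈ spectrum ℂ A) ∧ ∀ ε : ℝ, 0 < ε →
      ∃ P Q : Matrix (Fin n) (Fin n) ℂ, P * Q = 1 ∧ Q * P = 1 ∧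
        ‖Q * A * P - Matrix.diagonal d‖ ≤ ε := by
  obtain ⟨d, hd, h⟩ := exists_basis_near_diagonal n (Matrix.toLin' A) (by simp)
  refine ⟨d, fun i => ?_, fun ε hε => ?_⟩
  · have := (hd i).mem_spectrum
    rwa [← Matrix.spectrum_toLin'] 
  · obtain ⟨b, c, hc, hb⟩ := h (ε / (n + 1)) (by positivity)
    let e := Pi.basisFun ℂ (Fin n)
    have hPQ : e.toMatrix b * b.toMatrix e = 1 := e.toMatrix_mul_toMatrix_flip b
    have hQP : b.toMatrix e * e.toMatrix b = 1 := b.toMatrix_mul_toMatrix_flip e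
    refine ⟨e.toMatrix b, b.toMatrix e, hPQ, hQP, ?_⟩
    have key : A * e.toMatrix b = e.toMatrix b * (Matrix.diagonal d + Matrix.of c) := by
      ext i j
      have h1 := congrFun (hb j) i
      simp only [Matrix.toLin'_apply, Matrix.mulVec, dotProduct, Pi.add_apply, Pi.smul_apply,
        smul_eq_mul, Finset.sum_apply] at h1
      rw [Matrix.mul_add, Matrix.add_apply, Matrix.mul_diagonal]
      simp only [Matrix.mul_apply, e, Module.Basis.toMatrix_apply, Pi.basisFun_repr,
        Matrix.of_apply]
      rw [h1, mul_comm (d j)]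
      congr 1
      exact Finset.sum_congr rfl fun k _ => mul_comm (c k j) _
    rw [Matrix.mul_assoc, key, ← Matrix.mul_assoc, hQP, Matrix.one_mul, add_sub_cancel_left]
    refine (norm_le_of_entry_le (by positivity) hc).trans ?_
    rw [mul_div_assoc', div_le_iff₀ (by positivity)]
    nlinarith

/-! ### Open wedges and holomorphic parameter integrals -/

open MeasureTheory

/-- The interior of `wedge M b`. -/
def openWedge (M b : ℝ) : Set ℂ := {x | M < x.re ∧ |x.im| < b * (x.re - M)}

theorem isOpen_openWedge (M b : ℝ) : IsOpen (openWedge M b) :=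
  (isOpen_lt continuous_const Complex.continuous_re).inter
    (isOpen_lt Complex.continuous_im.abs
      (continuous_const.mul (Complex.continuous_re.sub continuous_const)))

theorem mem_openWedge_iff_sub_mem {M b : ℝ} {x : ℂ} :
    x ∈ openWedge M b ↔ x - M ∈ openWedge 0 b := by
  simp [openWedge]

theorem add_mem_openWedge {b : ℝ} {z w : ℂ} (hz : z ∈ openWedge 0 b) (hw : w ∈ openWedge 0 b) :
    z + w ∈ openWedge 0 b := by
  obtain ⟨h1, h2⟩ := hz
  obtain ⟨h3, h4⟩ := hw
  refine ⟨by simpa using add_pos h1 h3, ?_⟩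
  simp only [Complex.add_im, Complex.add_re]
  linarith [abs_add_le z.im w.im]

theorem real_mul_mem_openWedge {b t : ℝ} (ht : 0 < t) {z : ℂ} (hz : z ∈ openWedge 0 b) :
    (t : ℂ) * z ∈ openWedge 0 b := by
  obtain ⟨h1, h2⟩ := hz
  refine ⟨by simpa using mul_pos ht h1, ?_⟩
  simp only [Complex.im_ofReal_mul, Complex.re_ofReal_mul, abs_mul, abs_of_pos ht]
  nlinarith

/-- Cauchy's estimate on discs of radius `r / 2` dominates the `z`-derivative, so a bound on `F`
alone justifies differentiating under the integral. -/
theorem hasDerivAt_integral_of_holomorphic {μ : Measure ℝ} {U : Set ℂ} (hU : IsOpen U) {z₀ : ℂ}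
    (hz₀ : z₀ ∈ U) {F : ℂ → ℝ → ℂ} {bound : ℝ → ℝ} (hb : Integrable bound μ)
    (hF : ∀ᵐ t ∂μ, DifferentiableOn ℂ (F · t) U)
    (hmeas : ∀ z ∈ U, AEStronglyMeasurable (F z) μ)
    (hmeas' : AEStronglyMeasurable (fun t => deriv (F · t) z₀) μ)
    (hbound : ∀ᵐ t ∂μ, ∀ z ∈ U, ‖F z t‖ ≤ bound t) :
    Integrable (fun t => deriv (F · t) z₀) μ ∧
      HasDerivAt (fun z => ∫ t, F z t ∂μ) (∫ t, deriv (F · t) z₀ ∂μ) z₀ := by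
  obtain ⟨r, hr, hrU⟩ := Metric.isOpen_iff.1 hU z₀ hz₀
  have hsub : ∀ z ∈ Metric.ball z₀ (r / 2), Metric.closedBall z (r / 2) ⊆ U := by
    intro z hz w hw
    refine hrU ?_
    rw [Metric.mem_ball] at *
    rw [Metric.mem_closedBall] at hw
    linarith [dist_triangle w z z₀]
  refine hasDerivAt_integral_of_dominated_loc_of_deriv_le (s := Metric.ball z₀ (r / 2))
    (F' := fun z t => deriv (F · t) z) (bound := fun t => bound t / (r / 2))
    (Metric.ball_mem_nhds _ (by positivity)) ?_ ?_ hmeas' ?_ (hb.div_const _) ?_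
  · filter_upwards [hU.mem_nhds hz₀] with z hz using hmeas z hz
  · exact hb.mono' (hmeas _ hz₀) (hbound.mono fun t ht => ht _ hz₀)
  · filter_upwards [hF, hbound] with t ht htb z hz
    refine Complex.norm_deriv_le_of_forall_mem_sphere_norm_le (by positivity)
      ((ht.mono ?_).diffContOnCl) fun w hw => htb w (hsub z hz (Metric.sphere_subset_closedBall hw))
    exact Metric.closure_ball_subset_closedBall.trans (hsub z hz)
  · filter_upwards [hF] with t ht z hz
    exact (ht.differentiableAt (hU.mem_nhds (hsub z hz
      (Metric.mem_closedBall_self (by positivity))))).hasDerivAt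

theorem norm_exp_neg_mul_ofReal (μ : ℂ) (t : ℝ) :
    ‖Complex.exp (-(μ * t))‖ = Real.exp (-μ.re * t) := by
  rw [Complex.norm_exp]
  simp

/-! ### Scalar equation integrated from infinity -/

section Unstable

variable {b h B : ℝ} {e l : ℂ} {f : ℂ → ℂ}

/-- Duhamel's formula for `h u' = l u + f`, integrating from infinity in the direction `-e`. -/
noncomputable def unstableSolution (h : ℝ) (e l : ℂ) (f : ℂ → ℂ) (z : ℂ) : ℂ :=
  -e * ∫ t in Ioi (0 : ℝ), Complex.exp (-(l * e * t)) * f (z + h * t * e)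

theorem add_ray_mem (he : e ∈ openWedge 0 b) (hh : 0 < h) {t : ℝ} (ht : 0 ≤ t) {z : ℂ}
    (hz : z ∈ openWedge 0 b) : z + h * t * e ∈ openWedge 0 b := by
  rcases ht.eq_or_lt with rfl | ht
  · simpa using hz
  · exact add_mem_openWedge hz (by
      simpa using real_mul_mem_openWedge (mul_pos hh ht) he)

theorem hasDerivAt_unstable_integrand (he : e ∈ openWedge 0 b) (hh : 0 < h)
    (hf : DifferentiableOn ℂ f (openWedge 0 b)) {z : ℂ} (hz : z ∈ openWedge 0 b) {t : ℝ}
    (ht : 0 ≤ t) :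
    HasDerivAt (fun t : ℝ => Complex.exp (-(l * e * t)) * f (z + h * t * e))
      (-(l * e) * (Complex.exp (-(l * e * t)) * f (z + h * t * e)) +
        h * e * (Complex.exp (-(l * e * t)) * deriv f (z + h * t * e))) t := by
  have h1 : HasDerivAt f (deriv f (z + h * t * e)) (z + h * (t : ℂ) * e) :=
    (hf.differentiableAt ((isOpen_openWedge 0 b).mem_nhds (add_ray_mem he hh ht hz))).hasDerivAt
  have h2 : HasDerivAt (fun s : ℂ => z + h * s * e) (h * e) (t : ℂ) := by
    simpa using (((hasDerivAt_id (t : ℂ)).const_mul (h : ℂ)).mul_const e).const_add z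
  have h3 : HasDerivAt (fun s : ℂ => Complex.exp (-(l * e * s)))
      (Complex.exp (-(l * e * t)) * -(l * e)) (t : ℂ) := by
    simpa using ((hasDerivAt_id (t : ℂ)).const_mul (l * e)).neg.cexp
  have h4 := (h3.mul (h1.comp (t : ℂ) h2)).comp_ofReal
  refine h4.congr_deriv ?_
  simp only [Function.comp]
  ring

theorem integrable_unstable (he : e ∈ openWedge 0 b) (hh : 0 < h) (hle : 0 < (l * e).re)
    (hf : DifferentiableOn ℂ f (openWedge 0 b)) (hB : ∀ z ∈ openWedge 0 b, ‖f z‖ ≤ B)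
    {z : ℂ} (hz : z ∈ openWedge 0 b) :
    IntegrableOn (fun t : ℝ => Complex.exp (-(l * e * t)) * f (z + h * t * e)) (Ioi 0) := by
  refine Integrable.mono' (g := fun t => Real.exp (-(l * e).re * t) * B)
    ((exp_neg_integrableOn_Ioi 0 hle).mul_const B) ?_ ?_
  · exact ContinuousOn.aestronglyMeasurable (fun t ht => (hasDerivAt_unstable_integrand he hh hf hz
      (le_of_lt ht)).continuousAt.continuousWithinAt) measurableSet_Ioi
  · refine (ae_restrict_iff' measurableSet_Ioi).2 (.of_forall fun t ht => ?_)
    rw [norm_mul, norm_exp_neg_mul_ofReal]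
    gcongr
    exact hB _ (add_ray_mem he hh (le_of_lt ht) hz)

theorem norm_unstableSolution_le (he : e ∈ openWedge 0 b) (hh : 0 < h) (hle : 0 < (l * e).re)
    (hB : ∀ z ∈ openWedge 0 b, ‖f z‖ ≤ B)
    {z : ℂ} (hz : z ∈ openWedge 0 b) :
    ‖unstableSolution h e l f z‖ ≤ ‖e‖ / (l * e).re * B := by
  rw [unstableSolution, norm_mul, norm_neg, div_mul_eq_mul_div, mul_div_assoc]
  refine mul_le_mul_of_nonneg_left ?_ (norm_nonneg _)
  refine (norm_integral_le_of_norm_le (g := fun t => Real.exp (-(l * e).re * t) * B)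
    ((exp_neg_integrableOn_Ioi 0 hle).mul_const B) ?_).trans ?_
  · refine (ae_restrict_iff' measurableSet_Ioi).2 (.of_forall fun t ht => ?_)
    rw [norm_mul, norm_exp_neg_mul_ofReal]
    gcongr
    exact hB _ (add_ray_mem he hh (le_of_lt ht) hz)
  · rw [integral_mul_const, integral_exp_mul_Ioi (by linarith)]
    simp only [mul_zero, Real.exp_zero, neg_div_neg_eq]
    exact le_of_eq (by ring)

theorem hasDerivAt_unstableSolution (he : e ∈ openWedge 0 b) (hh : 0 < h) (hle : 0 < (l * e).re)
    (hf : DifferentiableOn ℂ f (openWedge 0 b)) (hB : ∀ z ∈ openWedge 0 b, ‖f z‖ ≤ B)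
    {z : ℂ} (hz : z ∈ openWedge 0 b) :
    HasDerivAt (unstableSolution h e l f) ((l * unstableSolution h e l f z + f z) / h) z := by
  have hO := isOpen_openWedge 0 b
  have hderiv : ∀ w ∈ openWedge 0 b, ∀ t : ℝ, 0 ≤ t →
      HasDerivAt (fun z => Complex.exp (-(l * e * t)) * f (z + h * t * e))
        (Complex.exp (-(l * e * t)) * deriv f (w + h * t * e)) w := by
    intro w hw t ht
    have h1 : HasDerivAt f (deriv f (w + h * t * e)) (w + h * (t : ℂ) * e) :=
      (hf.differentiableAt (hO.mem_nhds (add_ray_mem he hh ht hw))).hasDerivAt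
    simpa using ((h1.comp_add_const w _).const_mul (Complex.exp (-(l * e * t))))
  have hcont : ContinuousOn (fun t : ℝ => Complex.exp (-(l * e * t)) * deriv f (z + h * t * e))
      (Ioi 0) := by
    refine ContinuousOn.mul (by fun_prop) ?_
    refine (hf.deriv hO).continuousOn.comp (t := openWedge 0 b) (by fun_prop) ?_
    exact fun t ht => add_ray_mem he hh (le_of_lt ht) hz
  have hEq : ∀ t ∈ Ioi (0 : ℝ), deriv (fun z => Complex.exp (-(l * e * t)) * f (z + h * t * e)) z =
      Complex.exp (-(l * e * t)) * deriv f (z + h * t * e) :=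
    fun t ht => (hderiv z hz t (le_of_lt ht)).deriv
  obtain ⟨hint, hD⟩ := hasDerivAt_integral_of_holomorphic (μ := volume.restrict (Ioi (0 : ℝ)))
    hO hz (F := fun z t => Complex.exp (-(l * e * t)) * f (z + h * t * e))
    (bound := fun t => Real.exp (-(l * e).re * t) * B)
    ((exp_neg_integrableOn_Ioi 0 hle).mul_const B)
    ((ae_restrict_iff' measurableSet_Ioi).2 (.of_forall fun t ht w hw =>
      (hderiv w hw t (le_of_lt ht)).differentiableAt.differentiableWithinAt))
    (fun w hw => (integrable_unstable he hh hle hf hB hw).aestronglyMeasurable)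
    ((hcont.congr hEq).aestronglyMeasurable measurableSet_Ioi)
    ((ae_restrict_iff' measurableSet_Ioi).2 (.of_forall fun t ht w hw => by
      rw [norm_mul, norm_exp_neg_mul_ofReal]
      gcongr
      exact hB _ (add_ray_mem he hh (le_of_lt ht) hw)))
  rw [setIntegral_congr_fun measurableSet_Ioi hEq] at hD
  have hint' := (integrableOn_congr_fun hEq measurableSet_Ioi).1 hint
  have hint0 := integrable_unstable he hh hle hf hB hz
  have hlim : Tendsto (fun t : ℝ => Complex.exp (-(l * e * t)) * f (z + h * t * e)) atTop (𝓝 0) := by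
    refine squeeze_zero_norm' (a := fun t => Real.exp (-((l * e).re * t)) * B) ?_ ?_
    · filter_upwards [eventually_ge_atTop 0] with t ht
      rw [norm_mul, norm_exp_neg_mul_ofReal, neg_mul]
      gcongr
      exact hB _ (add_ray_mem he hh ht hz)
    · have := (Real.tendsto_exp_neg_atTop_nhds_zero.comp
        (tendsto_id.const_mul_atTop hle)).mul_const B
      simpa using this
  -- Integration by parts: the `t`-derivative of the integrand integrates to `-f z`, which expresses
  -- the integral of `deriv f` through the undifferentiated one and gives the equation.
  have key := integral_Ioi_of_hasDerivAt_of_tendsto'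
    (fun t ht => hasDerivAt_unstable_integrand (l := l) he hh hf hz ht)
    ((hint0.const_mul _).add (hint'.const_mul _)) hlim
  rw [integral_add (hint0.const_mul _) (hint'.const_mul _), integral_const_mul,
    integral_const_mul] at key
  simp only [Complex.ofReal_zero, mul_zero, neg_zero, Complex.exp_zero, zero_mul, add_zero, one_mul,
    zero_sub] at key
  have hh' : (h : ℂ) ≠ 0 := by exact_mod_cast hh.ne'
  refine (hD.const_mul (-e)).congr_deriv ?_
  rw [unstableSolution, eq_div_iff hh']
  linear_combination -key

end Unstable

/-! ### Scalar equation integrated from the vertex -/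

section Stable

variable {b h B : ℝ} {l : ℂ} {f g : ℂ → ℂ}

/-- On the wedge with vertex `0`, a primitive of `g` is `z ∫₀¹ g(t z) dt`. -/
theorem hasDerivAt_conePrimitive (hg : DifferentiableOn ℂ g (openWedge 0 b))
    (hB : ∀ R : ℝ, ∃ B : ℝ, ∀ z ∈ openWedge 0 b, ‖z‖ ≤ R → ‖g z‖ ≤ B)
    {z : ℂ} (hz : z ∈ openWedge 0 b) :
    IntegrableOn (fun t : ℝ => g (t * z)) (Ioc 0 1) ∧
    HasDerivAt (fun z => z * ∫ t in Ioc (0 : ℝ) 1, g (t * z)) (g z) z := by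
  have hO := isOpen_openWedge 0 b
  -- Bounds on bounded pieces suffice, since the segment from the vertex is bounded. The stable
  -- integrand contains `exp(-l s / h)`, which may be unbounded at infinity.
  obtain ⟨B, hB⟩ := hB (‖z‖ + 1)
  set U : Set ℂ := openWedge 0 b ∩ Metric.ball 0 (‖z‖ + 1) with hU
  have hUO : IsOpen U := hO.inter Metric.isOpen_ball
  have hzU : z ∈ U := ⟨hz, by simp⟩
  have hgU : ∀ w ∈ U, ∀ t ∈ Ioc (0 : ℝ) 1, ‖g (t * w)‖ ≤ B := by
    intro w hw t ht
    refine hB _ (real_mul_mem_openWedge ht.1 hw.1) ?_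
    have hw2 : ‖w‖ < ‖z‖ + 1 := by simpa using hw.2
    rw [norm_mul, Complex.norm_real, Real.norm_eq_abs, abs_of_pos ht.1]
    nlinarith [ht.2, ht.1, norm_nonneg w]
  have hderiv : ∀ w ∈ openWedge 0 b, ∀ t : ℝ, 0 < t →
      HasDerivAt (fun z => g (t * z)) (t * deriv g (t * w)) w := by
    intro w hw t ht
    have h1 : HasDerivAt g (deriv g (t * w)) ((t : ℂ) * w) :=
      (hg.differentiableAt (hO.mem_nhds (real_mul_mem_openWedge ht hw))).hasDerivAt
    have h2 : HasDerivAt (fun z : ℂ => (t : ℂ) * z) t w := by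
      simpa using (hasDerivAt_id w).const_mul (t : ℂ)
    exact (h1.comp w h2).congr_deriv (mul_comm _ _)
  have hcontg : ∀ w ∈ openWedge 0 b, ContinuousOn (fun t : ℝ => g (t * w)) (Ioc 0 1) := fun w hw =>
    hg.continuousOn.comp (by fun_prop) fun t ht => real_mul_mem_openWedge ht.1 hw
  have hcont : ContinuousOn (fun t : ℝ => (t : ℂ) * deriv g (t * z)) (Ioc 0 1) := by
    refine ContinuousOn.mul (by fun_prop) ?_
    exact (hg.deriv hO).continuousOn.comp (t := openWedge 0 b) (by fun_prop)
      fun t ht => real_mul_mem_openWedge ht.1 hz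
  have hEq : ∀ t ∈ Ioc (0 : ℝ) 1, deriv (fun z => g (t * z)) z = t * deriv g (t * z) :=
    fun t ht => (hderiv z hz t ht.1).deriv
  have hconst : IntegrableOn (fun _ : ℝ => B) (Ioc 0 1) := by simp
  have hint0 : IntegrableOn (fun t : ℝ => g (t * z)) (Ioc 0 1) :=
    hconst.mono' ((hcontg z hz).aestronglyMeasurable measurableSet_Ioc)
      ((ae_restrict_iff' measurableSet_Ioc).2 (.of_forall (hgU z hzU)))
  refine ⟨hint0, ?_⟩
  obtain ⟨hint, hD⟩ := hasDerivAt_integral_of_holomorphic (μ := volume.restrict (Ioc (0 : ℝ) 1))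
    hUO hzU (F := fun z t => g (t * z)) (bound := fun t => B) hconst
    ((ae_restrict_iff' measurableSet_Ioc).2 (.of_forall fun t ht w hw =>
      (hderiv w hw.1 t ht.1).differentiableAt.differentiableWithinAt))
    (fun w hw => (hcontg w hw.1).aestronglyMeasurable measurableSet_Ioc)
    ((hcont.congr hEq).aestronglyMeasurable measurableSet_Ioc)
    ((ae_restrict_iff' measurableSet_Ioc).2 (.of_forall fun t ht w hw => hgU w hw t ht))
  rw [setIntegral_congr_fun measurableSet_Ioc hEq] at hD
  have hint' := (integrableOn_congr_fun hEq measurableSet_Ioc).1 hint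
  have hψ : ∀ t : ℝ, 0 < t → HasDerivAt (fun t : ℝ => (t : ℂ) * g (t * z))
      (g (t * z) + z * (t * deriv g (t * z))) t := by
    intro t ht
    have h1 : HasDerivAt g (deriv g (t * z)) ((t : ℂ) * z) :=
      (hg.differentiableAt (hO.mem_nhds (real_mul_mem_openWedge ht hz))).hasDerivAt
    have h2 : HasDerivAt (fun s : ℂ => s * z) z (t : ℂ) := by
      simpa using (hasDerivAt_id (t : ℂ)).mul_const z
    have h3 := ((hasDerivAt_id (t : ℂ)).mul (h1.comp (t : ℂ) h2)).comp_ofReal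
    refine h3.congr_deriv ?_
    simp only [Function.comp, id]
    ring
  -- The vertex is outside the open wedge, so `t = 0` is reached as a limit: `t g(t z) → 0` because
  -- `g` is bounded near the vertex.
  have key := intervalIntegral.integral_eq_sub_of_hasDerivAt_of_tendsto (a := 0) (b := 1)
    (f := fun t : ℝ => (t : ℂ) * g (t * z)) (fa := 0) (fb := g z) zero_lt_one
    (fun t ht => hψ t ht.1)
    ((intervalIntegrable_iff_integrableOn_Ioc_of_le zero_le_one).2
      (hint0.add (hint'.const_mul z))) (by
      refine squeeze_zero_norm' (a := fun t => t * B) ?_ ?_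
      · filter_upwards [Ioc_mem_nhdsGT zero_lt_one] with t ht
        rw [norm_mul, Complex.norm_real, Real.norm_eq_abs, abs_of_pos ht.1]
        exact mul_le_mul_of_nonneg_left (hgU z hzU t ht) ht.1.le
      · have : Tendsto (fun t : ℝ => t * B) (𝓝 0) (𝓝 (0 * B)) := tendsto_id.mul_const B
        rw [zero_mul] at this
        exact this.mono_left nhdsWithin_le_nhds) (by
      have := (hψ 1 one_pos).continuousAt.tendsto
      simp only [Complex.ofReal_one, one_mul] at this
      exact this.mono_left nhdsWithin_le_nhds)
  rw [intervalIntegral.integral_of_le zero_le_one,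
    integral_add hint0 (hint'.const_mul z), integral_const_mul, sub_zero] at key
  refine ((hasDerivAt_id z).mul hD).congr_deriv ?_
  rw [← key]
  simp

/-- Duhamel's formula for `h u' = l u + f`, integrating from the vertex of the wedge. -/
noncomputable def stableSolution (h : ℝ) (l : ℂ) (f : ℂ → ℂ) (z : ℂ) : ℂ :=
  Complex.exp (l / h * z) / h * (z * ∫ t in Ioc (0 : ℝ) 1, Complex.exp (-(l / h * (t * z))) * f (t * z))

theorem differentiableOn_stable_integrand (hf : DifferentiableOn ℂ f (openWedge 0 b)) :
    DifferentiableOn ℂ (fun s => Complex.exp (-(l / h * s)) * f s) (openWedge 0 b) :=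
  DifferentiableOn.mul (by fun_prop) hf

theorem norm_stable_integrand_le (hB : ∀ z ∈ openWedge 0 b, ‖f z‖ ≤ B) (R : ℝ) :
    ∃ B' : ℝ, ∀ z ∈ openWedge 0 b, ‖z‖ ≤ R → ‖Complex.exp (-(l / h * z)) * f z‖ ≤ B' := by
  refine ⟨Real.exp (‖l / h‖ * R) * B, fun z hz hzR => ?_⟩
  rw [norm_mul]
  have : ‖Complex.exp (-(l / h * z))‖ ≤ Real.exp (‖l / h‖ * R) := by
    refine (Complex.norm_exp_le_exp_norm _).trans ?_
    rw [norm_neg, norm_mul]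
    gcongr
  exact mul_le_mul this (hB z hz) (norm_nonneg _) (Real.exp_nonneg _)

theorem hasDerivAt_stableSolution (hh : 0 < h)
    (hf : DifferentiableOn ℂ f (openWedge 0 b)) (hB : ∀ z ∈ openWedge 0 b, ‖f z‖ ≤ B)
    {z : ℂ} (hz : z ∈ openWedge 0 b) :
    HasDerivAt (stableSolution h l f) ((l * stableSolution h l f z + f z) / h) z := by
  have hh' : (h : ℂ) ≠ 0 := by exact_mod_cast hh.ne'
  have h1 := (hasDerivAt_conePrimitive (differentiableOn_stable_integrand (l := l) (h := h) hf)
    (norm_stable_integrand_le hB) hz).2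
  have h2 : HasDerivAt (fun z => Complex.exp (l / h * z) / h)
      (Complex.exp (l / h * z) * (l / h) / h) z := by
    simpa using (((hasDerivAt_id z).const_mul (l / h)).cexp).div_const (h : ℂ)
  refine (h2.mul h1).congr_deriv ?_
  rw [stableSolution, Complex.exp_neg]
  have := Complex.exp_ne_zero (l / h * z)
  field_simp

/-- The kernel carrying `t z` to `z` is at most `exp(-k (1 - t))` with `k = c ‖z‖ / h`. Its mass `1
/ k` cancels the prefactor `‖z‖ / h`, leaving neither `h` nor `z` in the constant. -/
theorem norm_stableSolution_le {c : ℝ} (hc : 0 < c) (hh : 0 < h)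
    (hl : ∀ z ∈ openWedge 0 b, (l * z).re ≤ -c * ‖z‖) (hB : ∀ z ∈ openWedge 0 b, ‖f z‖ ≤ B)
    {z : ℂ} (hz : z ∈ openWedge 0 b) :
    ‖stableSolution h l f z‖ ≤ 1 / c * B := by
  have hz0 : 0 < ‖z‖ := by
    refine norm_pos_iff.2 fun h0 => ?_
    have := hz.1
    simp [h0] at this
  have hB0 : 0 ≤ B := (norm_nonneg _).trans (hB z hz)
  have hh' : (h : ℂ) ≠ 0 := by exact_mod_cast hh.ne'
  set k : ℝ := c * ‖z‖ / h with hk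
  have hk0 : 0 < k := by positivity
  have heq : stableSolution h l f z = z / h *
      ∫ t in Ioc (0 : ℝ) 1, Complex.exp (l / h * z) * (Complex.exp (-(l / h * (t * z))) * f (t * z)) := by
    rw [integral_const_mul, stableSolution]
    ring
  have hexp : ∀ t ∈ Ioc (0 : ℝ) 1,
      ‖Complex.exp (l / h * z) * (Complex.exp (-(l / h * (t * z))) * f (t * z))‖ ≤
        Real.exp (-k * (1 - t)) * B := by
    intro t ht
    rw [← mul_assoc, ← Complex.exp_add, norm_mul]
    refine mul_le_mul ?_ (hB _ (real_mul_mem_openWedge ht.1 hz)) (norm_nonneg _)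
      (Real.exp_nonneg _)
    rw [Complex.norm_exp, Real.exp_le_exp]
    have : l / h * z + -(l / h * (t * z)) = (((1 - t) / h : ℝ) : ℂ) * (l * z) := by
      push_cast
      field_simp
      ring
    rw [this, Complex.re_ofReal_mul]
    calc (1 - t) / h * (l * z).re ≤ (1 - t) / h * (-c * ‖z‖) :=
          mul_le_mul_of_nonneg_left (hl z hz) (div_nonneg (by linarith [ht.2]) hh.le)
      _ = -k * (1 - t) := by rw [hk]; ring
  have hderiv : ∀ t : ℝ, HasDerivAt (fun t => Real.exp (-k * (1 - t)) / k) (Real.exp (-k * (1 - t))) t := by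
    intro t
    have := ((((hasDerivAt_id t).const_sub 1).const_mul (-k)).exp).div_const k
    refine this.congr_deriv ?_
    simp only [id]
    field_simp
  have hval : ∫ t in Ioc (0 : ℝ) 1, Real.exp (-k * (1 - t)) ≤ 1 / k := by
    rw [← intervalIntegral.integral_of_le zero_le_one,
      intervalIntegral.integral_eq_sub_of_hasDerivAt (fun t _ => hderiv t)
        ((by fun_prop : Continuous fun t : ℝ => Real.exp (-k * (1 - t))).intervalIntegrable 0 1)]
    simp only [sub_self, mul_zero, Real.exp_zero]
    have : 0 ≤ Real.exp (-k * (1 - 0)) / k := by positivity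
    linarith
  rw [heq, norm_mul, norm_div, Complex.norm_real, Real.norm_eq_abs, abs_of_pos hh]
  calc _ ≤ ‖z‖ / h * ∫ t in Ioc (0 : ℝ) 1, Real.exp (-k * (1 - t)) * B := by
        gcongr
        refine norm_integral_le_of_norm_le ?_
          ((ae_restrict_iff' measurableSet_Ioc).2 (.of_forall hexp))
        exact (by fun_prop : Continuous fun t : ℝ => Real.exp (-k * (1 - t)) * B).integrableOn_Ioc
    _ ≤ ‖z‖ / h * (1 / k * B) := by
        rw [integral_mul_const]
        gcongr
    _ = 1 / c * B := by
        rw [hk]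
        field_simp

end Stable

/-! ### Scalar solution operator uniform in `h` -/

/-- For `l ≠ 0` and a narrow enough wedge, `h u' = l u + f` has a solution operator, additive and
bounded in the sup norm uniformly in `h`. -/
theorem exists_scalar_solution_operator {b : ℝ} (hb : 0 < b) {l : ℂ} (hl : l ≠ 0)
    (hs : l.re < 0 → 2 * (b * |l.im|) ≤ -l.re) :
    ∃ C : ℝ, 0 < C ∧ ∀ (M h : ℝ), 0 < h → ∃ K : (ℂ → ℂ) → ℂ → ℂ,
      ∀ (f : ℂ → ℂ) (B : ℝ), DifferentiableOn ℂ f (openWedge M b) →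
        (∀ x ∈ openWedge M b, ‖f x‖ ≤ B) →
        (∀ x ∈ openWedge M b, HasDerivAt (K f) ((l * K f x + f x) / h) x) ∧
        (∀ x ∈ openWedge M b, ‖K f x‖ ≤ C * B) ∧
        ∀ (g : ℂ → ℂ) (B' : ℝ), DifferentiableOn ℂ g (openWedge M b) →
          (∀ x ∈ openWedge M b, ‖g x‖ ≤ B') → ∀ x ∈ openWedge M b,
          K (fun x => f x - g x) x = K f x - K g x := by
  suffices H : ∃ C : ℝ, 0 < C ∧ ∀ h : ℝ, 0 < h → ∃ K : (ℂ → ℂ) → ℂ → ℂ,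
      ∀ (f : ℂ → ℂ) (B : ℝ), DifferentiableOn ℂ f (openWedge 0 b) →
        (∀ x ∈ openWedge 0 b, ‖f x‖ ≤ B) →
        (∀ x ∈ openWedge 0 b, HasDerivAt (K f) ((l * K f x + f x) / h) x) ∧
        (∀ x ∈ openWedge 0 b, ‖K f x‖ ≤ C * B) ∧
        ∀ (g : ℂ → ℂ) (B' : ℝ), DifferentiableOn ℂ g (openWedge 0 b) →
          (∀ x ∈ openWedge 0 b, ‖g x‖ ≤ B') → ∀ x ∈ openWedge 0 b,
          K (fun x => f x - g x) x = K f x - K g x by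
    obtain ⟨C, hC, H⟩ := H
    refine ⟨C, hC, fun M h hh => ?_⟩
    obtain ⟨K, hK⟩ := H h hh
    refine ⟨fun f x => K (fun z => f (z + M)) (x - M), fun f B hf hB => ?_⟩
    have hmem : ∀ z ∈ openWedge 0 b, z + M ∈ openWedge M b := fun z hz => by
      rw [mem_openWedge_iff_sub_mem]
      simpa using hz
    have hsh : ∀ {f : ℂ → ℂ}, DifferentiableOn ℂ f (openWedge M b) →
        DifferentiableOn ℂ (fun z => f (z + M)) (openWedge 0 b) := fun hf =>
      hf.comp (by fun_prop) hmem
    obtain ⟨h1, h2, h3⟩ := hK _ B (hsh hf) fun z hz => hB _ (hmem z hz)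
    refine ⟨fun x hx => ?_, fun x hx => h2 _ (mem_openWedge_iff_sub_mem.1 hx),
      fun g B' hg hB' x hx => h3 _ B' (hsh hg) (fun z hz => hB' _ (hmem z hz)) _
        (mem_openWedge_iff_sub_mem.1 hx)⟩
    simpa using (h1 _ (mem_openWedge_iff_sub_mem.1 hx)).comp_sub_const x (M : ℂ)
  rcases lt_or_ge l.re 0 with hre | hre
  · have hs := hs hre
    -- Narrowness gives `Re (l z) ≤ (Re l / 2) Re z`, and `‖z‖ ≤ (1 + b) Re z` on the wedge.
    set c : ℝ := -l.re / (2 * (1 + b)) with hc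
    have hcpos : 0 < c := div_pos (by linarith) (by positivity)
    have hlz : ∀ z ∈ openWedge 0 b, (l * z).re ≤ -c * ‖z‖ := by
      rintro z ⟨h1, h2⟩
      rw [sub_zero] at h2
      have h3 : ‖z‖ ≤ (1 + b) * z.re := by
        have := Complex.norm_le_abs_re_add_abs_im z
        rw [abs_of_pos h1] at this
        linarith
      have h4 : c * ‖z‖ ≤ -l.re / 2 * z.re := by
        calc c * ‖z‖ ≤ c * ((1 + b) * z.re) := by gcongr
          _ = -l.re / 2 * z.re := by rw [hc]; field_simp
      have h5 : -(l.im * z.im) ≤ |l.im| * (b * z.re) := by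
        refine (neg_le_abs _).trans ?_
        rw [abs_mul]
        gcongr
      rw [Complex.mul_re]
      nlinarith
    refine ⟨1 / c, by positivity, fun h hh => ⟨stableSolution h l, fun f B hf hB => ⟨fun x hx =>
      hasDerivAt_stableSolution hh hf hB hx, fun x hx => norm_stableSolution_le hcpos hh hlz hB hx,
      fun g B' hg hB' x hx => ?_⟩⟩⟩
    have i1 := (hasDerivAt_conePrimitive (differentiableOn_stable_integrand (l := l) (h := h) hf)
      (norm_stable_integrand_le hB) hx).1
    have i2 := (hasDerivAt_conePrimitive (differentiableOn_stable_integrand (l := l) (h := h) hg)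
      (norm_stable_integrand_le hB') hx).1
    simp only [stableSolution, mul_sub]
    rw [integral_sub i1 i2]
    ring
  -- For `Re l > 0` the real direction works; for `Re l = 0` it is tilted so that `Im e` has the
  -- sign opposite to `Im l`.
  · obtain ⟨e, he, hle⟩ : ∃ e ∈ openWedge 0 b, 0 < (l * e).re := by
      rcases hre.eq_or_lt with h0 | h0
      · have him : l.im ≠ 0 := fun h => hl (Complex.ext h0.symm h)
        rcases lt_or_gt_of_ne him with hi | hi
        · refine ⟨⟨1, b / 2⟩, ⟨by simp, ?_⟩, ?_⟩
          · rw [abs_of_pos (by positivity)]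
            simp only [sub_zero, mul_one]
            linarith
          · rw [Complex.mul_re, ← h0]
            simp only
            nlinarith
        · refine ⟨⟨1, -(b / 2)⟩, ⟨by simp, ?_⟩, ?_⟩
          · rw [abs_neg, abs_of_pos (by positivity)]
            simp only [sub_zero, mul_one]
            linarith
          · rw [Complex.mul_re, ← h0]
            simp only
            nlinarith
      · exact ⟨1, ⟨by simp, by simpa using hb⟩, by simpa using h0⟩
    have he0 : 0 < ‖e‖ := norm_pos_iff.2 fun h => by simp [h] at hle
    refine ⟨‖e‖ / (l * e).re, by positivity, fun h hh => ⟨unstableSolution h e l, fun f B hf hB =>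
      ⟨fun x hx => hasDerivAt_unstableSolution he hh hle hf hB hx,
      fun x hx => norm_unstableSolution_le he hh hle hB hx, fun g B' hg hB' x hx => ?_⟩⟩⟩
    have i1 := integrable_unstable he hh hle hf hB hx
    have i2 := integrable_unstable he hh hle hg hB' hx
    simp only [unstableSolution, mul_sub]
    rw [integral_sub i1 i2]
    ring

/-! ### Entrywise calculus for matrix-valued functions -/

section MatrixCalculus

variable {k m n : ℕ}

theorem norm_entry_le (A : Matrix (Fin n) (Fin m) ℂ) (i : Fin n) (j : Fin m) : ‖A i j‖ ≤ ‖A‖ := by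
  rw [← coe_nnnorm, ← coe_nnnorm, Matrix.linfty_opNNNorm_def]
  norm_cast
  refine le_trans ?_ (Finset.le_sup (f := fun i => ∑ j, ‖A i j‖₊) (Finset.mem_univ i))
  exact Finset.single_le_sum (f := fun j => ‖A i j‖₊) (fun _ _ => zero_le) (Finset.mem_univ j)

variable {ι κ : Type*} [Fintype ι] [Fintype κ]

theorem hasDerivAt_matrix_iff {F : ℂ → Matrix ι κ ℂ}
    {F' : Matrix ι κ ℂ} {x : ℂ} :
    HasDerivAt F F' x ↔ ∀ i j, HasDerivAt (fun z => F z i j) (F' i j) x := by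
  classical
  constructor
  · intro h i j
    exact ((Matrix.entryLinearMap ℂ ℂ i j).toContinuousLinearMap.hasFDerivAt.comp_hasDerivAt x h :)
  · intro h
    have h1 : HasDerivAt (fun z => ∑ i, ∑ j, F z i j • Matrix.single i j (1 : ℂ))
        (∑ i, ∑ j, F' i j • Matrix.single i j (1 : ℂ)) x :=
      HasDerivAt.fun_sum fun i _ => HasDerivAt.fun_sum fun j _ => (h i j).smul_const _
    have h2 : ∀ A : Matrix ι κ ℂ, ∑ i, ∑ j, A i j • Matrix.single i j (1 : ℂ) = A := by
      intro A
      conv_rhs => rw [Matrix.matrix_eq_sum_single A]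
      simp
    simpa only [h2] using h1

theorem differentiableOn_matrix_iff {F : ℂ → Matrix ι κ ℂ} {U : Set ℂ} (hU : IsOpen U) :
    DifferentiableOn ℂ F U ↔ ∀ i j, DifferentiableOn ℂ (fun z => F z i j) U := by
  refine ⟨fun h i j x hx => ?_, fun h x hx => ?_⟩
  · exact (hasDerivAt_matrix_iff.1 (h.differentiableAt (hU.mem_nhds hx)).hasDerivAt i
      j).differentiableAt.differentiableWithinAt
  · refine ((hasDerivAt_matrix_iff (F' := Matrix.of fun i j => deriv (fun z => F z i j) x)).2
      fun i j => ((h i j).differentiableAt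
        (hU.mem_nhds hx)).hasDerivAt).differentiableAt.differentiableWithinAt

theorem differentiableOn_matrix_mul {ν : Type*} [Fintype ν]
    {A : ℂ → Matrix ι κ ℂ} {B : ℂ → Matrix κ ν ℂ}
    {U : Set ℂ} (hU : IsOpen U) (hA : DifferentiableOn ℂ A U) (hB : DifferentiableOn ℂ B U) :
    DifferentiableOn ℂ (fun x => A x * B x) U := by
  rw [differentiableOn_matrix_iff hU] at *
  intro i j
  simp only [Matrix.mul_apply]
  exact DifferentiableOn.fun_sum fun l _ => (hA i l).mul (hB l j)

end MatrixCalculus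

/-! ### Contraction principle for bounded holomorphic functions -/

section FixedPoint

open BoundedContinuousFunction

variable {E : Type*} [NormedAddCommGroup E] {U : Set ℂ}

open Classical in
/-- Extension by zero of a function on a subset. -/
noncomputable def zeroExt (u : U → E) (x : ℂ) : E := if h : x ∈ U then u ⟨x, h⟩ else 0

theorem zeroExt_coe (u : U → E) (x : U) : zeroExt u x = u x := by
  simp [zeroExt]

variable [NormedSpace ℂ E] [CompleteSpace E]

/-- By Weierstrass, uniform limits of holomorphic functions are holomorphic; this makes the ball
used for the contraction complete. -/
theorem isClosed_setOf_differentiableOn_zeroExt (hU : IsOpen U) (R : ℝ) :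
    IsClosed {u : U →ᵇ E | DifferentiableOn ℂ (zeroExt u) U ∧ ∀ x, ‖u x‖ ≤ R} := by
  refine IsSeqClosed.isClosed fun u v hu hv => ⟨?_, fun x => ?_⟩
  · have h1 : TendstoUniformlyOn (fun n => zeroExt (u n)) (zeroExt v) atTop U := by
      rw [Metric.tendstoUniformlyOn_iff]
      intro ε hε
      filter_upwards [Metric.tendstoUniformly_iff.1
        (BoundedContinuousFunction.tendsto_iff_tendstoUniformly.1 hv) ε hε] with n hn x hx
      simpa [zeroExt, hx] using hn ⟨x, hx⟩
    exact h1.tendstoLocallyUniformlyOn.differentiableOn (.of_forall fun n => (hu n).1) hU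
  · exact le_of_tendsto ((BoundedContinuousFunction.tendsto_iff_tendstoUniformly.1 hv).tendsto_at
      x).norm (.of_forall fun n => (hu n).2 x)

/-- The contraction principle for the equation `y = K (F(·, y))` in the space of bounded holomorphic
functions. -/
theorem exists_holomorphic_fixedPoint (hU : IsOpen U) {C R : ℝ} (hC : 0 < C) (hR : 0 ≤ R)
    {K : (ℂ → E) → ℂ → E}
    (hK : ∀ (f : ℂ → E) (B : ℝ), DifferentiableOn ℂ f U → (∀ x ∈ U, ‖f x‖ ≤ B) →
      DifferentiableOn ℂ (K f) U ∧ (∀ x ∈ U, ‖K f x‖ ≤ C * B) ∧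
      ∀ (g : ℂ → E) (B' : ℝ), DifferentiableOn ℂ g U → (∀ x ∈ U, ‖g x‖ ≤ B') →
        ∀ x ∈ U, K (fun x => f x - g x) x = K f x - K g x)
    {F : ℂ → E → E}
    (hF : ∀ y : ℂ → E, DifferentiableOn ℂ y U → DifferentiableOn ℂ (fun x => F x (y x)) U)
    (hF0 : ∀ x ∈ U, ‖F x 0‖ ≤ R / (2 * C))
    (hFL : ∀ x ∈ U, ∀ y z, ‖y‖ ≤ R → ‖z‖ ≤ R → ‖F x y - F x z‖ ≤ 1 / (2 * C) * ‖y - z‖) :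
    ∃ y : ℂ → E, DifferentiableOn ℂ y U ∧ (∀ x ∈ U, ‖y x‖ ≤ R) ∧
      (∀ x ∈ U, ‖F x (y x)‖ ≤ R / C) ∧ ∀ x ∈ U, y x = K (fun x => F x (y x)) x := by
  set s : Set (U →ᵇ E) := {u | DifferentiableOn ℂ (zeroExt u) U ∧ ∀ x, ‖u x‖ ≤ R} with hs
  have hsc : IsClosed s := isClosed_setOf_differentiableOn_zeroExt hU R
  have hle : ∀ u : s, ∀ x ∈ U, ‖zeroExt u.1 x‖ ≤ R := fun u x hx => by
    simpa [zeroExt, hx] using u.2.2 ⟨x, hx⟩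
  -- Half of `R / C` comes from `F x 0`, half from the Lipschitz bound; applying `K` then returns to
  -- the ball of radius `R`.
  have hFB : ∀ u : s, ∀ x ∈ U, ‖F x (zeroExt u.1 x)‖ ≤ R / C := by
    intro u x hx
    have h1 := hFL x hx _ 0 (hle u x hx) (by simpa using hR)
    have h2 : 1 / (2 * C) * ‖zeroExt u.1 x - 0‖ ≤ 1 / (2 * C) * R := by
      rw [sub_zero]
      gcongr
      exact hle u x hx
    calc ‖F x (zeroExt u.1 x)‖ = ‖(F x (zeroExt u.1 x) - F x 0) + F x 0‖ := by rw [sub_add_cancel]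
      _ ≤ 1 / (2 * C) * R + R / (2 * C) := (norm_add_le _ _).trans (add_le_add (h1.trans h2) (hF0 x hx))
      _ = R / C := by field_simp; ring
  have hKu := fun u : s => hK _ _ (hF _ u.2.1) (hFB u)
  have hbd : ∀ u : s, ∀ x : U, ‖K (fun x => F x (zeroExt u.1 x)) x‖ ≤ R := fun u x =>
    ((hKu u).2.1 x x.2).trans_eq (by field_simp)
  let Φ : s → s := fun u => ⟨BoundedContinuousFunction.ofNormedAddCommGroup
    (fun x : U => K (fun x => F x (zeroExt u.1 x)) x)
    ((hKu u).1.continuousOn.domRestrict) R (hbd u), by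
      refine (hKu u).1.congr fun x hx => ?_
      simp [zeroExt, hx], fun x => hbd u x⟩
  have hΦ : ContractingWith (1 / 2) Φ := by
    refine ⟨by rw [← NNReal.coe_lt_coe]; norm_num, LipschitzWith.of_dist_le_mul fun u v => ?_⟩
    refine (BoundedContinuousFunction.dist_le (by positivity)).2 fun x => ?_
    have h1 : ∀ x ∈ U, ‖F x (zeroExt u.1 x) - F x (zeroExt v.1 x)‖ ≤ 1 / (2 * C) * dist u v := by
      intro x hx
      refine (hFL x hx _ _ (hle u x hx) (hle v x hx)).trans ?_
      gcongr
      simp only [zeroExt, hx, dif_pos]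
      rw [← dist_eq_norm]
      exact BoundedContinuousFunction.dist_coe_le_dist _
    -- `K` respects differences, so the Lipschitz constant of the map is `C * (1 / (2 * C)) = 1 /
    -- 2`.
    have h2 := (hK _ _ ((hF _ u.2.1).sub (hF _ v.2.1)) h1).2.1 x x.2
    have h3 := (hKu u).2.2 _ _ (hF _ v.2.1) (hFB v) x x.2
    rw [dist_eq_norm]
    change ‖K (fun x => F x (zeroExt u.1 x)) x - K (fun x => F x (zeroExt v.1 x)) x‖ ≤ _
    rw [← h3]
    refine h2.trans_eq ?_
    push_cast
    field_simp
  have : CompleteSpace s := hsc.completeSpace_coe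
  have h0 : zeroExt ((0 : U →ᵇ E) : U → E) = fun _ => 0 := by
    ext x
    simp [zeroExt]
  have : Nonempty s := ⟨⟨0, by rw [h0]; exact differentiableOn_const _, fun x => by simpa using hR⟩⟩
  obtain ⟨u, hu⟩ : ∃ u, Φ u = u := ⟨_, hΦ.fixedPoint_isFixedPt⟩
  refine ⟨zeroExt u.1, u.2.1, hle u, hFB u, fun x hx => ?_⟩
  have := congrArg (fun w : s => w.1 ⟨x, hx⟩) hu
  exact (zeroExt_coe (u.1 : U → E) ⟨x, hx⟩).trans this.symm

end FixedPoint

/-! ### Matrix systems and exponentially convergent solutions -/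

/-- The Hadamard product decouples the entries, so the scalar operators apply separately. The bound
on `m * ‖(d i j)⁻¹‖` lets the same `C` control the algebraic equation for the equilibrium. -/
theorem exists_matrix_solution_operator {m n : ℕ} {b : ℝ} (hb : 0 < b) {d : Matrix (Fin n) (Fin m) ℂ}
    (hd : ∀ i j, d i j ≠ 0) (hs : ∀ i j, (d i j).re < 0 → 2 * (b * |(d i j).im|) ≤ -(d i j).re) :
    ∃ C : ℝ, 0 < C ∧ (∀ i j, m * ‖(d i j)⁻¹‖ ≤ C) ∧ ∀ (M h : ℝ), 0 < h →
      ∃ K : (ℂ → Matrix (Fin n) (Fin m) ℂ) → ℂ → Matrix (Fin n) (Fin m) ℂ,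
      ∀ (f : ℂ → Matrix (Fin n) (Fin m) ℂ) (B : ℝ), DifferentiableOn ℂ f (openWedge M b) →
        (∀ x ∈ openWedge M b, ‖f x‖ ≤ B) →
        (∀ x ∈ openWedge M b,
          HasDerivAt (K f) ((h : ℂ)⁻¹ • (Matrix.hadamard d (K f x) + f x)) x) ∧
        (∀ x ∈ openWedge M b, ‖K f x‖ ≤ C * B) ∧
        ∀ (g : ℂ → Matrix (Fin n) (Fin m) ℂ) (B' : ℝ), DifferentiableOn ℂ g (openWedge M b) →
          (∀ x ∈ openWedge M b, ‖g x‖ ≤ B') → ∀ x ∈ openWedge M b,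
          K (fun x => f x - g x) x = K f x - K g x := by
  choose c hc H using fun i j => exists_scalar_solution_operator hb (hd i j) (hs i j)
  have hsum : ∀ i j, c i j + ‖(d i j)⁻¹‖ ≤ ∑ i, ∑ j, (c i j + ‖(d i j)⁻¹‖) := fun i j => by
    refine le_trans ?_ (Finset.single_le_sum (f := fun i => ∑ j, (c i j + ‖(d i j)⁻¹‖))
      (fun i _ => Finset.sum_nonneg fun j _ => by have := hc i j; positivity) (Finset.mem_univ i))
    exact Finset.single_le_sum (f := fun j => c i j + ‖(d i j)⁻¹‖)
      (fun j _ => by have := hc i j; positivity) (Finset.mem_univ j)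
  have hS : 0 ≤ ∑ i, ∑ j, (c i j + ‖(d i j)⁻¹‖) :=
    Finset.sum_nonneg fun i _ => Finset.sum_nonneg fun j _ => by have := hc i j; positivity
  set S := ∑ i, ∑ j, (c i j + ‖(d i j)⁻¹‖)
  refine ⟨m * S + 1, by positivity, fun i j => ?_, fun M h hh => ?_⟩
  · have h1 : ‖(d i j)⁻¹‖ ≤ S := by linarith [hsum i j, hc i j]
    have : (m : ℝ) * ‖(d i j)⁻¹‖ ≤ m * S := by gcongr
    linarith
  choose k hk using fun i j => H i j M h hh
  have hO := isOpen_openWedge M b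
  refine ⟨fun f x => Matrix.of fun i j => k i j (fun x => f x i j) x, fun f B hf hB => ?_⟩
  have hij : ∀ {f : ℂ → Matrix (Fin n) (Fin m) ℂ} {B : ℝ}, (∀ x ∈ openWedge M b, ‖f x‖ ≤ B) →
      ∀ i j, ∀ x ∈ openWedge M b, ‖f x i j‖ ≤ B :=
    fun hB i j x hx => (norm_entry_le _ i j).trans (hB x hx)
  have hk' := fun i j => hk i j _ B ((differentiableOn_matrix_iff hO).1 hf i j) (hij hB i j)
  refine ⟨fun x hx => hasDerivAt_matrix_iff.2 fun i j => ?_, fun x hx => ?_,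
    fun g B' hg hB' x hx => ?_⟩
  · refine ((hk' i j).1 x hx).congr_deriv ?_
    simp only [Matrix.smul_apply, Matrix.add_apply, Matrix.hadamard_apply, Matrix.of_apply,
      smul_eq_mul]
    ring
  · have hB0 : 0 ≤ B := (norm_nonneg _).trans (hB x hx)
    refine (norm_le_of_entry_le (r := S * B) (by positivity) fun i j => ?_).trans ?_
    · refine ((hk' i j).2.1 x hx).trans ?_
      gcongr
      linarith [hsum i j, norm_nonneg (d i j)⁻¹]
    · nlinarith
  · ext i j
    exact (hk' i j).2.2 _ B' ((differentiableOn_matrix_iff hO).1 hg i j) (hij hB' i j) x hx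

theorem hadamard_inv_norm_le {m n : ℕ} {d A : Matrix (Fin n) (Fin m) ℂ} {C : ℝ}
    (hC : 0 < C) (hd : ∀ i j, m * ‖(d i j)⁻¹‖ ≤ C) :
    ‖Matrix.hadamard (Matrix.of fun i j => (d i j)⁻¹) A‖ ≤ C * ‖A‖ := by
  rcases Nat.eq_zero_or_pos m with rfl | hm
  · refine (norm_le_of_entry_le (r := 0) le_rfl fun i j => j.elim0).trans ?_
    simpa using by positivity
  · have hm' : (0 : ℝ) < m := by exact_mod_cast hm
    refine (norm_le_of_entry_le (r := C / m * ‖A‖) (by positivity) fun i j => ?_).trans_eq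
      (by field_simp)
    rw [Matrix.hadamard_apply, norm_mul, Matrix.of_apply]
    refine mul_le_mul ?_ (norm_entry_le A i j) (norm_nonneg _) (by positivity)
    rw [le_div_iff₀ hm', mul_comm]
    exact hd i j

/-- The singularly perturbed system `h y' = d ⊙ y + Φ(x, y)` has a solution converging
exponentially to an equilibrium of the limiting system. -/
theorem exists_convergent_solution {m n : ℕ} {b : ℝ} (hb : 0 < b) {d : Matrix (Fin n) (Fin m) ℂ}
    (hd : ∀ i j, d i j ≠ 0) (hs : ∀ i j, (d i j).re < 0 → 2 * (b * |(d i j).im|) ≤ -(d i j).re) :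
    ∃ C : ℝ, 0 < C ∧ ∀ M h η δ Ra Rv : ℝ, 0 ≤ M → 0 < h → 0 ≤ η → 0 ≤ Ra → 0 ≤ Rv →
      ∀ (Φ : ℂ → Matrix (Fin n) (Fin m) ℂ → Matrix (Fin n) (Fin m) ℂ)
        (Φinf : Matrix (Fin n) (Fin m) ℂ → Matrix (Fin n) (Fin m) ℂ),
      (∀ y : ℂ → Matrix (Fin n) (Fin m) ℂ, DifferentiableOn ℂ y (openWedge M b) →
        DifferentiableOn ℂ (fun x => Φ x (y x)) (openWedge M b)) →
      (∀ y : ℂ → Matrix (Fin n) (Fin m) ℂ, DifferentiableOn ℂ y univ → DifferentiableOn ℂ (fun x => Φinf (y x)) univ) →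
      (∀ x ∈ openWedge M b, ∀ y z, ‖y‖ ≤ Ra + Rv → ‖z‖ ≤ Ra + Rv →
        ‖Φ x y - Φ x z‖ ≤ δ * ‖y - z‖) →
      (∀ y z, ‖y‖ ≤ Ra → ‖z‖ ≤ Ra → ‖Φinf y - Φinf z‖ ≤ δ * ‖y - z‖) →
      δ + h * η ≤ 1 / (2 * C) → ‖Φinf 0‖ ≤ Ra / (2 * C) →
      (∀ a, ‖a‖ ≤ Ra → ∀ x ∈ openWedge M b,
        ‖Φ x a - Φinf a‖ ≤ Rv / (2 * C) * Real.exp (-η * x.re)) →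
      ∃ (y : ℂ → Matrix (Fin n) (Fin m) ℂ) (a : Matrix (Fin n) (Fin m) ℂ),
        (∀ x ∈ openWedge M b,
          HasDerivAt y ((h : ℂ)⁻¹ • (Matrix.hadamard d (y x) + Φ x (y x))) x) ∧
        ‖a‖ ≤ Ra ∧ (Φinf 0 = 0 → a = 0) ∧
        ∀ x ∈ openWedge M b, ‖y x - a‖ ≤ Rv * Real.exp (-η * x.re) := by
  obtain ⟨C, hC, hdC, H⟩ := exists_matrix_solution_operator hb hd hs
  refine ⟨C, hC, fun M h η δ Ra Rv hM hh hη hRa hRv Φ Φinf hΦ hΦinf hL hLinf hδ hΦ0 hconv => ?_⟩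
  have hhη : 0 ≤ h * η := by positivity
  have hO := isOpen_openWedge M b
  -- The equilibrium `d ⊙ a = -Φinf a` comes from the same contraction principle, with entrywise
  -- division as `K` and `F` independent of `x`; evaluation at any point would do.
  obtain ⟨y₀, -, hy₀R, -, hy₀⟩ := exists_holomorphic_fixedPoint (E := Matrix (Fin n) (Fin m) ℂ)
    isOpen_univ hC hRa
    (K := fun f x => -Matrix.hadamard (Matrix.of fun i j => (d i j)⁻¹) (f x)) (F := fun _ => Φinf)
    (fun f B hf hB => ⟨by
      have hf' := (differentiableOn_matrix_iff isOpen_univ).1 hf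
      refine (differentiableOn_matrix_iff isOpen_univ).2 fun i j => ?_
      simp only [Matrix.neg_apply, Matrix.hadamard_apply]
      exact ((hf' i j).const_mul _).neg, fun x hx => by
      rw [norm_neg]
      exact (hadamard_inv_norm_le hC hdC).trans (mul_le_mul_of_nonneg_left (hB x hx) hC.le),
      fun g B' _ _ x _ => by
        ext i j
        simp only [Matrix.neg_apply, Matrix.hadamard_apply, Matrix.sub_apply]
        ring⟩)
    hΦinf (fun _ _ => hΦ0) (fun _ _ y z hy hz => (hLinf y z hy hz).trans (by
      gcongr
      linarith))
  set a := y₀ 0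
  have ha : ‖a‖ ≤ Ra := hy₀R 0 trivial
  have haeq : a = -Matrix.hadamard (Matrix.of fun i j => (d i j)⁻¹) (Φinf a) := hy₀ 0 trivial
  have hda : Matrix.hadamard d a = -Φinf a := by
    conv_lhs => rw [haeq]
    ext i j
    simp only [Matrix.hadamard_apply, Matrix.neg_apply, Matrix.of_apply]
    have := hd i j
    field_simp
  have ha0 : Φinf 0 = 0 → a = 0 := by
    intro h0
    have h1 : ‖a‖ ≤ C * ‖Φinf a‖ := by
      conv_lhs => rw [haeq, norm_neg]
      exact hadamard_inv_norm_le hC hdC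
    have h2 := hLinf a 0 ha (by simpa using hRa)
    rw [h0, sub_zero, sub_zero] at h2
    have h3 : ‖a‖ ≤ 1 / 2 * ‖a‖ := by
      calc ‖a‖ ≤ C * (1 / (2 * C) * ‖a‖) := by
            refine h1.trans (mul_le_mul_of_nonneg_left (h2.trans ?_) hC.le)
            gcongr
            linarith
        _ = 1 / 2 * ‖a‖ := by field_simp
    exact norm_le_zero_iff.1 (by linarith)
  have hexp1 : ∀ x : ℂ, ‖Complex.exp (-η * x)‖ = Real.exp (-η * x.re) := fun x => by
    rw [Complex.norm_exp]; simp
  have hexp2 : ∀ x : ℂ, ‖Complex.exp (η * x)‖ = Real.exp (η * x.re) := fun x => by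
    rw [Complex.norm_exp]; simp
  have hexple : ∀ x ∈ openWedge M b, Real.exp (-η * x.re) ≤ 1 := fun x hx => by
    rw [Real.exp_le_one_iff]
    nlinarith [hx.1]
  have hexpmul : ∀ r : ℝ, Real.exp (η * r) * Real.exp (-η * r) = 1 := fun r => by
    rw [← Real.exp_add]; simp
  have hball : ∀ x ∈ openWedge M b, ∀ v : Matrix (Fin n) (Fin m) ℂ, ‖v‖ ≤ Rv →
      ‖a + Complex.exp (-η * x) • v‖ ≤ Ra + Rv := by
    intro x hx v hv
    refine (norm_add_le _ _).trans (add_le_add ha ?_)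
    rw [norm_smul, hexp1]
    nlinarith [hexple x hx, norm_nonneg v, Real.exp_pos (-η * x.re)]
  -- Substituting `y = a + exp(-η x) v` and `d ⊙ a = -Φinf a` gives `h v' = d ⊙ v + F x v`. The two
  -- exponentials cancel in the Lipschitz estimate.
  let F : ℂ → Matrix (Fin n) (Fin m) ℂ → Matrix (Fin n) (Fin m) ℂ := fun x v =>
    ((h * η : ℝ) : ℂ) • v + Complex.exp (η * x) • (Φ x (a + Complex.exp (-η * x) • v) - Φinf a)
  have hFd : ∀ y : ℂ → Matrix (Fin n) (Fin m) ℂ, DifferentiableOn ℂ y (openWedge M b) →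
      DifferentiableOn ℂ (fun x => F x (y x)) (openWedge M b) := by
    intro y hy
    have hexpd : ∀ c : ℂ, DifferentiableOn ℂ (fun x => Complex.exp (c * x)) (openWedge M b) :=
      fun c => by fun_prop
    exact (hy.const_smul ((h * η : ℝ) : ℂ)).add ((hexpd η).smul
      ((hΦ _ (((hexpd (-η)).smul hy).const_add a)).sub_const _))
  obtain ⟨K, hK⟩ := H M h hh
  obtain ⟨v, hv, hvR, hFB, hvK⟩ := exists_holomorphic_fixedPoint (E := Matrix (Fin n) (Fin m) ℂ)
    (U := openWedge M b) hO hC hRv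
    (K := K) (fun f B hf hB => ⟨fun x hx =>
      ((hK f B hf hB).1 x hx).differentiableAt.differentiableWithinAt, (hK f B hf hB).2⟩)
    (F := F) hFd
    (by
      intro x hx
      simp only [F, smul_zero, zero_add, add_zero]
      rw [norm_smul, hexp2]
      calc _ ≤ Real.exp (η * x.re) * (Rv / (2 * C) * Real.exp (-η * x.re)) := by
            gcongr
            exact hconv a ha x hx
        _ = Rv / (2 * C) := by linear_combination (Rv / (2 * C)) * hexpmul x.re)
    (by
      intro x hx v w hv hw
      have h1 := hL x hx _ _ (hball x hx v hv) (hball x hx w hw)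
      rw [add_sub_add_left_eq_sub, ← smul_sub, norm_smul, hexp1] at h1
      have h2 : F x v - F x w = ((h * η : ℝ) : ℂ) • (v - w) + Complex.exp (η * x) • (Φ x (a + Complex.exp (-η * x) • v) -
            Φ x (a + Complex.exp (-η * x) • w)) := by
        simp only [F, smul_sub]
        abel
      rw [h2]
      refine (norm_add_le _ _).trans ?_
      rw [norm_smul, norm_smul, hexp2, Complex.norm_real, Real.norm_eq_abs, abs_of_nonneg hhη]
      calc _ ≤ h * η * ‖v - w‖ + Real.exp (η * x.re) * (δ * (Real.exp (-η * x.re) * ‖v - w‖)) := by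
            gcongr
        _ = (δ + h * η) * ‖v - w‖ := by linear_combination (δ * ‖v - w‖) * hexpmul x.re
        _ ≤ _ := by gcongr)
  have hFv := hK _ _ (hFd v hv) hFB
  refine ⟨fun x => a + Complex.exp (-η * x) • v x, a, fun x hx => ?_, ha, ha0, fun x hx => ?_⟩
  · have h1 := (hFv.1 x hx).congr_of_eventuallyEq
      (Filter.eventuallyEq_of_mem (hO.mem_nhds hx) hvK)
    rw [← hvK x hx] at h1
    have h2 : HasDerivAt (fun x : ℂ => Complex.exp (-η * x)) (Complex.exp (-η * x) * -η) x := by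
      simpa using ((hasDerivAt_id x).const_mul (-η : ℂ)).cexp
    refine ((h2.smul h1).const_add a).congr_deriv ?_
    have hh' : (h : ℂ) ≠ 0 := by exact_mod_cast hh.ne'
    have he : Complex.exp (-(η * x)) * Complex.exp (η * x) = 1 := by
      rw [← Complex.exp_add]; simp
    ext i j
    have hdij := congrFun (congrFun hda i) j
    simp only [Matrix.hadamard_apply, Matrix.neg_apply] at hdij
    simp only [Matrix.add_apply, Matrix.smul_apply, Matrix.sub_apply, Matrix.hadamard_apply,
      smul_eq_mul, F, neg_mul]
    push_cast
    field_simp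
    linear_combination (Φ x (a + Complex.exp (-(η * x)) • v x) i j - Φinf a i j) * he - hdij
  · rw [add_sub_cancel_left, norm_smul, hexp1, mul_comm]
    gcongr
    exact hvR x hx

/-! ### Matrix Riccati equations -/

/-- The right-hand side of a matrix Riccati equation. -/
def riccati {m n : ℕ} (s : ℂ) (A₂ : Matrix (Fin n) (Fin n) ℂ) (A₁ : Matrix (Fin m) (Fin m) ℂ)
    (G : Matrix (Fin n) (Fin m) ℂ) (B₂ : Matrix (Fin n) (Fin n) ℂ) (B₁ : Matrix (Fin m) (Fin m) ℂ)
    (K : Matrix (Fin m) (Fin n) ℂ) (y : Matrix (Fin n) (Fin m) ℂ) : Matrix (Fin n) (Fin m) ℂ :=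
  A₂ * y - y * A₁ + G + s • (B₂ * y - y * B₁) - s ^ 2 • (y * K * y)

/-- `F` is holomorphic and bounded by `Γ` on `U`, and converges to `L` exponentially with rate `η`
(which may vanish). -/
structure ConvergesOn {m n : ℕ} (U : Set ℂ) (Γ η : ℝ) (F : ℂ → Matrix (Fin m) (Fin n) ℂ)
    (L : Matrix (Fin m) (Fin n) ℂ) : Prop where
  differentiableOn : DifferentiableOn ℂ F U
  norm_le : ∀ x ∈ U, ‖F x‖ ≤ Γ
  norm_limit_le : ‖L‖ ≤ Γ
  norm_sub_le : ∀ x ∈ U, ‖F x - L‖ ≤ Γ * Real.exp (-η * x.re)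

theorem ConvergesOn.mono {m n : ℕ} {U V : Set ℂ} {Γ Γ' η : ℝ} {F : ℂ → Matrix (Fin m) (Fin n) ℂ}
    {L : Matrix (Fin m) (Fin n) ℂ} (h : ConvergesOn U Γ η F L) (hV : V ⊆ U) (hΓ : Γ ≤ Γ') :
    ConvergesOn V Γ' η F L :=
  ⟨h.differentiableOn.mono hV, fun x hx => (h.norm_le x (hV hx)).trans hΓ, h.norm_limit_le.trans hΓ,
    fun x hx => (h.norm_sub_le x (hV hx)).trans (by gcongr)⟩

theorem norm_mul_mul_le {k l m n : ℕ} {Q : Matrix (Fin k) (Fin l) ℂ} {P : Matrix (Fin m) (Fin n) ℂ}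
    {N r : ℝ} (hN : 0 ≤ N) (hQ : ‖Q‖ ≤ N) (hP : ‖P‖ ≤ N) {A : Matrix (Fin l) (Fin m) ℂ}
    (hA : ‖A‖ ≤ r) : ‖Q * A * P‖ ≤ N ^ 2 * r := by
  have hr : 0 ≤ r := (norm_nonneg _).trans hA
  calc ‖Q * A * P‖ ≤ ‖Q * A‖ * ‖P‖ := Matrix.linfty_opNorm_mul _ _
    _ ≤ (N * r) * N := by
        refine mul_le_mul ((Matrix.linfty_opNorm_mul _ _).trans ?_) hP (norm_nonneg _)
          (by positivity)
        exact mul_le_mul hQ hA (norm_nonneg _) hN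
    _ = N ^ 2 * r := by ring

theorem ConvergesOn.conj {k l m n : ℕ} {U : Set ℂ} (hU : IsOpen U) {Γ η N : ℝ}
    {F : ℂ → Matrix (Fin l) (Fin m) ℂ} {L : Matrix (Fin l) (Fin m) ℂ} (h : ConvergesOn U Γ η F L)
    {Q : Matrix (Fin k) (Fin l) ℂ} {P : Matrix (Fin m) (Fin n) ℂ}
    (hN : 0 ≤ N) (hQ : ‖Q‖ ≤ N) (hP : ‖P‖ ≤ N) :
    ConvergesOn U (N ^ 2 * Γ) η (fun x => Q * F x * P) (Q * L * P) := by
  refine ⟨?_, fun x hx => norm_mul_mul_le hN hQ hP (h.norm_le x hx),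
    norm_mul_mul_le hN hQ hP h.norm_limit_le, fun x hx => ?_⟩
  · exact differentiableOn_matrix_mul hU (differentiableOn_matrix_mul hU
      (differentiableOn_const _) h.differentiableOn) (differentiableOn_const _)
  · rw [← Matrix.sub_mul, ← Matrix.mul_sub, mul_assoc]
    exact norm_mul_mul_le hN hQ hP (h.norm_sub_le x hx)

section Riccati

variable {m n : ℕ} {A₂ A₂' B₂ B₂' : Matrix (Fin n) (Fin n) ℂ} {A₁ A₁' B₁ B₁' : Matrix (Fin m) (Fin m) ℂ}
  {G G' y z : Matrix (Fin n) (Fin m) ℂ} {K K' : Matrix (Fin m) (Fin n) ℂ}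

/-- Allows solving in nearly diagonal coordinates and returning through `y ↦ P₂ y Q₁`. -/
theorem riccati_conj {P₁ Q₁ : Matrix (Fin m) (Fin m) ℂ} {P₂ Q₂ : Matrix (Fin n) (Fin n) ℂ}
    (h₁ : P₁ * Q₁ = 1) (h₂ : P₂ * Q₂ = 1) (s : ℂ) :
    P₂ * riccati s (Q₂ * A₂ * P₂) (Q₁ * A₁ * P₁) (Q₂ * G * P₁) (Q₂ * B₂ * P₂) (Q₁ * B₁ * P₁)
      (Q₁ * K * P₂) y * Q₁ = riccati s A₂ A₁ G B₂ B₁ K (P₂ * y * Q₁) := by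
  have h₂' : ∀ X : Matrix (Fin n) (Fin m) ℂ, P₂ * (Q₂ * X) = X := fun X => by
    rw [← Matrix.mul_assoc, h₂, Matrix.one_mul]
  simp only [riccati, Matrix.mul_add, Matrix.add_mul, Matrix.mul_sub, Matrix.sub_mul,
    Matrix.mul_smul, Matrix.smul_mul, Matrix.mul_assoc, h₂', h₁, Matrix.mul_one]

/-- Splits off the diagonal part of the Sylvester operator; what remains is again of Riccati form,
with small `A₁`, `A₂`. -/
theorem hadamard_add_riccati (d₁ : Fin m → ℂ) (d₂ : Fin n → ℂ) (s : ℂ) :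
    Matrix.hadamard (Matrix.of fun i j => d₂ i - d₁ j) y + riccati s (A₂ - Matrix.diagonal d₂)
      (A₁ - Matrix.diagonal d₁) G B₂ B₁ K y = riccati s A₂ A₁ G B₂ B₁ K y := by
  have : Matrix.hadamard (Matrix.of fun i j => d₂ i - d₁ j) y =
      Matrix.diagonal d₂ * y - y * Matrix.diagonal d₁ := by
    ext i j
    simp only [Matrix.hadamard_apply, Matrix.of_apply, Matrix.sub_apply, Matrix.diagonal_mul,
      Matrix.mul_diagonal]
    ring
  rw [this]
  simp only [riccati, Matrix.sub_mul, Matrix.mul_sub]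
  abel

/-- The source `G` cancels and every other term carries `ε` or `s`; the quadratic one splits as `(y
- z) K y + z K (y - z)`, with `s ^ 2 ≤ s`. -/
theorem norm_riccati_sub_riccati_le {s ε Γ R : ℝ} (hs : 0 ≤ s) (hs1 : s ≤ 1)
    (hA₂ : ‖A₂‖ ≤ ε) (hA₁ : ‖A₁‖ ≤ ε)
    (hB₂ : ‖B₂‖ ≤ Γ) (hB₁ : ‖B₁‖ ≤ Γ) (hK : ‖K‖ ≤ Γ) (hy : ‖y‖ ≤ R) (hz : ‖z‖ ≤ R) :
    ‖riccati s A₂ A₁ G B₂ B₁ K y - riccati s A₂ A₁ G B₂ B₁ K z‖ ≤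
      (2 * ε + s * (2 * Γ + 2 * Γ * R)) * ‖y - z‖ := by
  have hR : 0 ≤ R := (norm_nonneg _).trans hy
  have hmul : ∀ {k l q : ℕ} {X : Matrix (Fin k) (Fin l) ℂ} {Y : Matrix (Fin l) (Fin q) ℂ} {r t : ℝ},
      ‖X‖ ≤ r → ‖Y‖ ≤ t → ‖X * Y‖ ≤ r * t := fun hX hY =>
    (Matrix.linfty_opNorm_mul _ _).trans
      (mul_le_mul hX hY (norm_nonneg _) ((norm_nonneg _).trans hX))
  have heq : riccati s A₂ A₁ G B₂ B₁ K y - riccati s A₂ A₁ G B₂ B₁ K z =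
      (A₂ * (y - z) - (y - z) * A₁) + (s : ℂ) • (B₂ * (y - z) - (y - z) * B₁) -
        (s : ℂ) ^ 2 • ((y - z) * (K * y) + (z * K) * (y - z)) := by
    simp only [riccati, Matrix.mul_sub, Matrix.sub_mul, ← Matrix.mul_assoc, smul_sub, smul_add]
    abel
  set D := ‖y - z‖
  have hD : ‖y - z‖ ≤ D := le_rfl
  have hsn : ‖(s : ℂ)‖ = s := by rw [Complex.norm_real, Real.norm_eq_abs, abs_of_nonneg hs]
  rw [heq]
  refine (norm_sub_le _ _).trans ((add_le_add_left (norm_add_le _ _) _).trans ?_)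
  rw [norm_smul, norm_smul, norm_pow, hsn]
  have h1 : ‖A₂ * (y - z) - (y - z) * A₁‖ ≤ ε * D + D * ε :=
    (norm_sub_le _ _).trans (add_le_add (hmul hA₂ hD) (hmul hD hA₁))
  have h2 : ‖B₂ * (y - z) - (y - z) * B₁‖ ≤ Γ * D + D * Γ :=
    (norm_sub_le _ _).trans (add_le_add (hmul hB₂ hD) (hmul hD hB₁))
  have h3 : ‖(y - z) * (K * y) + (z * K) * (y - z)‖ ≤ D * (Γ * R) + (R * Γ) * D :=
    (norm_add_le _ _).trans (add_le_add (hmul hD (hmul hK hy)) (hmul (hmul hz hK) hD))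
  have hs2 : s ^ 2 ≤ s := by nlinarith
  calc _ ≤ (ε * D + D * ε) + s * (Γ * D + D * Γ) + s * (D * (Γ * R) + (R * Γ) * D) := by
        gcongr
    _ = _ := by ring

/-- Dependence on the coefficients at fixed `y`. At the equilibrium this measures how far `a` is
from solving the equation at finite `x`. -/
theorem norm_riccati_sub_riccati_le' {s g R : ℝ} (hs : 0 ≤ s) (hs1 : s ≤ 1)
    (hA₂ : ‖A₂ - A₂'‖ ≤ g) (hA₁ : ‖A₁ - A₁'‖ ≤ g) (hG : ‖G - G'‖ ≤ g)
    (hB₂ : ‖B₂ - B₂'‖ ≤ g) (hB₁ : ‖B₁ - B₁'‖ ≤ g) (hK : ‖K - K'‖ ≤ g) (hy : ‖y‖ ≤ R) :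
    ‖riccati s A₂ A₁ G B₂ B₁ K y - riccati s A₂' A₁' G' B₂' B₁' K' y‖ ≤
      (1 + 4 * R + R ^ 2) * g := by
  have hR : 0 ≤ R := (norm_nonneg _).trans hy
  have hg : 0 ≤ g := (norm_nonneg _).trans hA₂
  have hmul : ∀ {k l q : ℕ} {X : Matrix (Fin k) (Fin l) ℂ} {Y : Matrix (Fin l) (Fin q) ℂ} {r t : ℝ},
      ‖X‖ ≤ r → ‖Y‖ ≤ t → ‖X * Y‖ ≤ r * t := fun hX hY =>
    (Matrix.linfty_opNorm_mul _ _).trans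
      (mul_le_mul hX hY (norm_nonneg _) ((norm_nonneg _).trans hX))
  have heq : riccati s A₂ A₁ G B₂ B₁ K y - riccati s A₂' A₁' G' B₂' B₁' K' y =
      ((A₂ - A₂') * y - y * (A₁ - A₁')) + (G - G') + (s : ℂ) • ((B₂ - B₂') * y - y * (B₁ - B₁')) -
        (s : ℂ) ^ 2 • (y * (K - K') * y) := by
    simp only [riccati, Matrix.mul_sub, Matrix.sub_mul, smul_sub]
    abel
  have hsn : ‖(s : ℂ)‖ = s := by rw [Complex.norm_real, Real.norm_eq_abs, abs_of_nonneg hs]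
  rw [heq]
  refine (norm_sub_le _ _).trans ((add_le_add_left ((norm_add_le _ _).trans
    (add_le_add_left (norm_add_le _ _) _)) _).trans ?_)
  rw [norm_smul, norm_smul, norm_pow, hsn]
  have h1 : ‖(A₂ - A₂') * y - y * (A₁ - A₁')‖ ≤ g * R + R * g :=
    (norm_sub_le _ _).trans (add_le_add (hmul hA₂ hy) (hmul hy hA₁))
  have h2 : ‖(B₂ - B₂') * y - y * (B₁ - B₁')‖ ≤ g * R + R * g :=
    (norm_sub_le _ _).trans (add_le_add (hmul hB₂ hy) (hmul hy hB₁))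
  have h3 : ‖y * (K - K') * y‖ ≤ R * g * R := hmul (hmul hy hK) hy
  have hs2 : s ^ 2 ≤ 1 := by nlinarith
  calc _ ≤ (g * R + R * g) + g + 1 * (g * R + R * g) + 1 * (R * g * R) := by
        gcongr
    _ = _ := by ring

theorem differentiableOn_riccati {U : Set ℂ} (hU : IsOpen U) (s : ℂ)
    {A₂ B₂ : ℂ → Matrix (Fin n) (Fin n) ℂ} {A₁ B₁ : ℂ → Matrix (Fin m) (Fin m) ℂ}
    {G y : ℂ → Matrix (Fin n) (Fin m) ℂ} {K : ℂ → Matrix (Fin m) (Fin n) ℂ}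
    (hA₂ : DifferentiableOn ℂ A₂ U) (hA₁ : DifferentiableOn ℂ A₁ U) (hG : DifferentiableOn ℂ G U)
    (hB₂ : DifferentiableOn ℂ B₂ U) (hB₁ : DifferentiableOn ℂ B₁ U) (hK : DifferentiableOn ℂ K U)
    (hy : DifferentiableOn ℂ y U) :
    DifferentiableOn ℂ (fun x => riccati s (A₂ x) (A₁ x) (G x) (B₂ x) (B₁ x) (K x) (y x)) U := by
  have h1 := differentiableOn_matrix_mul hU hA₂ hy
  have h2 := differentiableOn_matrix_mul hU hy hA₁
  have h3 := differentiableOn_matrix_mul hU hB₂ hy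
  have h4 := differentiableOn_matrix_mul hU hy hB₁
  have h5 := differentiableOn_matrix_mul hU (differentiableOn_matrix_mul hU hy hK) hy
  exact (((h1.sub h2).add hG).add ((h3.sub h4).const_smul s)).sub (h5.const_smul (s ^ 2))

end Riccati

/-- The radii depend only on `C` and `Γ`, so the smallness of `ε`, `s` and `h η` can be imposed
after they are known. -/
theorem exists_riccati_solution_of_near_diagonal {m n : ℕ} {b : ℝ} (hb : 0 < b)
    {d₁ : Fin m → ℂ} {d₂ : Fin n → ℂ} (hd : ∀ i j, d₂ i ≠ d₁ j)
    (hs : ∀ i j, (d₂ i - d₁ j).re < 0 → 2 * (b * |(d₂ i - d₁ j).im|) ≤ -(d₂ i - d₁ j).re) :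
    ∃ C : ℝ, 0 < C ∧ ∀ Γ : ℝ, 0 ≤ Γ → ∃ Ra Rv : ℝ, 0 ≤ Ra ∧ 0 ≤ Rv ∧
      ∀ M h η ε s : ℝ, 0 ≤ M → 0 < h → 0 ≤ η → 0 ≤ s → s ≤ 1 →
      2 * ε + s * (2 * Γ + 2 * Γ * (Ra + Rv)) + h * η ≤ 1 / (2 * C) →
      ∀ (A₂ B₂ : ℂ → Matrix (Fin n) (Fin n) ℂ) (A₁ B₁ : ℂ → Matrix (Fin m) (Fin m) ℂ)
        (G : ℂ → Matrix (Fin n) (Fin m) ℂ) (K : ℂ → Matrix (Fin m) (Fin n) ℂ)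
        (A₂' B₂' : Matrix (Fin n) (Fin n) ℂ) (A₁' B₁' : Matrix (Fin m) (Fin m) ℂ)
        (G' : Matrix (Fin n) (Fin m) ℂ) (K' : Matrix (Fin m) (Fin n) ℂ),
      ConvergesOn (openWedge M b) Γ η (fun x => A₂ x - Matrix.diagonal d₂)
        (A₂' - Matrix.diagonal d₂) →
      ConvergesOn (openWedge M b) Γ η (fun x => A₁ x - Matrix.diagonal d₁)
        (A₁' - Matrix.diagonal d₁) →
      ConvergesOn (openWedge M b) Γ η G G' →
      ConvergesOn (openWedge M b) Γ η B₂ B₂' → ConvergesOn (openWedge M b) Γ η B₁ B₁' →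
      ConvergesOn (openWedge M b) Γ η K K' →
      (∀ x ∈ openWedge M b, ‖A₂ x - Matrix.diagonal d₂‖ ≤ ε) → ‖A₂' - Matrix.diagonal d₂‖ ≤ ε →
      (∀ x ∈ openWedge M b, ‖A₁ x - Matrix.diagonal d₁‖ ≤ ε) → ‖A₁' - Matrix.diagonal d₁‖ ≤ ε →
      ∃ (y : ℂ → Matrix (Fin n) (Fin m) ℂ) (a : Matrix (Fin n) (Fin m) ℂ),
        (∀ x ∈ openWedge M b, HasDerivAt y
          ((h : ℂ)⁻¹ • riccati s (A₂ x) (A₁ x) (G x) (B₂ x) (B₁ x) (K x) (y x)) x) ∧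
        ‖a‖ ≤ Ra ∧ (G' = 0 → a = 0) ∧
        ∀ x ∈ openWedge M b, ‖y x - a‖ ≤ Rv * Real.exp (-η * x.re) := by
  obtain ⟨C, hC, H⟩ := exists_convergent_solution hb
    (d := Matrix.of fun i j => d₂ i - d₁ j) (fun i j => sub_ne_zero.2 (hd i j)) hs
  refine ⟨C, hC, fun Γ hΓ => ?_⟩
  -- Chosen so that `‖G'‖ ≤ Γ = Ra / (2 * C)`; likewise `Rv` matches the coefficient-variation bound
  -- at `‖a‖ ≤ Ra`.
  set Ra := 2 * C * Γ with hRa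
  have hRa0 : 0 ≤ Ra := by positivity
  set Rv := 2 * C * ((1 + 4 * Ra + Ra ^ 2) * Γ) with hRv
  have hRv0 : 0 ≤ Rv := by positivity
  refine ⟨Ra, Rv, hRa0, hRv0, ?_⟩
  intro M h η ε s hM hh hη hs0 hs1 hsmall A₂ B₂ A₁ B₁ G K A₂' B₂' A₁' B₁' G' K' cA₂ cA₁ cG cB₂
    cB₁ cK hA₂ hA₂' hA₁ hA₁'
  have hO := isOpen_openWedge M b
  obtain ⟨y, a, h1, h2, h3, h4⟩ := H M h η (2 * ε + s * (2 * Γ + 2 * Γ * (Ra + Rv))) Ra Rv hM hh hη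
    hRa0 hRv0
    (fun x y => riccati s (A₂ x - Matrix.diagonal d₂) (A₁ x - Matrix.diagonal d₁) (G x) (B₂ x)
      (B₁ x) (K x) y)
    (riccati s (A₂' - Matrix.diagonal d₂) (A₁' - Matrix.diagonal d₁) G' B₂' B₁' K')
    (fun y hy => differentiableOn_riccati hO s cA₂.differentiableOn cA₁.differentiableOn
      cG.differentiableOn cB₂.differentiableOn cB₁.differentiableOn cK.differentiableOn hy)
    (fun y hy => differentiableOn_riccati isOpen_univ s (differentiableOn_const _)
      (differentiableOn_const _) (differentiableOn_const _) (differentiableOn_const _)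
      (differentiableOn_const _) (differentiableOn_const _) hy)
    (fun x hx y z hy hz => norm_riccati_sub_riccati_le hs0 hs1 (hA₂ x hx) (hA₁ x hx)
      (cB₂.norm_le x hx) (cB₁.norm_le x hx) (cK.norm_le x hx) hy hz)
    (fun y z hy hz => norm_riccati_sub_riccati_le hs0 hs1 hA₂' hA₁' cB₂.norm_limit_le
      cB₁.norm_limit_le cK.norm_limit_le (by linarith) (by linarith))
    hsmall
    (by
      have : riccati s (A₂' - Matrix.diagonal d₂) (A₁' - Matrix.diagonal d₁) G' B₂' B₁' K' 0 = G' := by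
        simp [riccati]
      rw [this, hRa]
      refine cG.norm_limit_le.trans_eq ?_
      field_simp)
    (fun a ha x hx => by
      refine (norm_riccati_sub_riccati_le' hs0 hs1 (cA₂.norm_sub_le x hx) (cA₁.norm_sub_le x hx)
        (cG.norm_sub_le x hx) (cB₂.norm_sub_le x hx) (cB₁.norm_sub_le x hx) (cK.norm_sub_le x hx)
        ha).trans_eq ?_
      rw [hRv]
      field_simp)
  refine ⟨y, a, fun x hx => ?_, h2, fun hG => h3 (by simp [riccati, hG]), h4⟩
  have := h1 x hx
  rwa [hadamard_add_riccati] at this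

theorem openWedge_mono {M M' b b' : ℝ} (hM : M ≤ M') (hb : b' ≤ b) (hb' : 0 ≤ b) :
    openWedge M' b' ⊆ openWedge M b := by
  rintro x ⟨h1, h2⟩
  refine ⟨hM.trans_lt h1, h2.trans_le ?_⟩
  calc b' * (x.re - M') ≤ b * (x.re - M') := mul_le_mul_of_nonneg_right hb (by linarith)
    _ ≤ b * (x.re - M) := by gcongr

theorem hasDerivAt_matrix_mul_mul {k l m n : ℕ} (P : Matrix (Fin k) (Fin l) ℂ)
    (Q : Matrix (Fin m) (Fin n) ℂ) {y : ℂ → Matrix (Fin l) (Fin m) ℂ}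
    {y' : Matrix (Fin l) (Fin m) ℂ} {x : ℂ} (h : HasDerivAt y y' x) :
    HasDerivAt (fun x => P * y x * Q) (P * y' * Q) x := by
  have h := hasDerivAt_matrix_iff.1 h
  refine hasDerivAt_matrix_iff.2 fun i j => ?_
  simp only [Matrix.mul_apply]
  exact HasDerivAt.fun_sum fun a _ => (HasDerivAt.fun_sum fun c _ =>
    (h c a).const_mul _).mul_const _

/-- Conjugating a family close to its limit by a similarity which makes the limiting matrix nearly
diagonal. -/
theorem convergesOn_conj_sub_diagonal {n : ℕ} {U : Set ℂ} (hU : IsOpen U)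
    {A : ℂ → Matrix (Fin n) (Fin n) ℂ} {L L₀ P Q : Matrix (Fin n) (Fin n) ℂ} {d : Fin n → ℂ}
    {N C η η' ε Γ : ℝ} (hA : DifferentiableOn ℂ A U) (hN : 0 ≤ N) (hQ : ‖Q‖ ≤ N) (hP : ‖P‖ ≤ N)
    (hd : ‖Q * L₀ * P - Matrix.diagonal d‖ ≤ ε / 3) (hL : N ^ 2 * ‖L - L₀‖ ≤ ε / 3)
    (hη : η ≤ η') (hU0 : ∀ x ∈ U, 0 ≤ x.re)
    (hsmall : ∀ x ∈ U, N ^ 2 * (C * Real.exp (-η' * x.re)) ≤ ε / 3)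
    (hAL : ∀ x ∈ U, ‖A x - L‖ ≤ C * Real.exp (-η' * x.re)) (hε : 0 ≤ ε) (hΓε : ε ≤ Γ)
    (hΓ : N ^ 2 * C ≤ Γ) :
    ConvergesOn U Γ η (fun x => Q * A x * P - Matrix.diagonal d) (Q * L * P - Matrix.diagonal d) ∧
      (∀ x ∈ U, ‖Q * A x * P - Matrix.diagonal d‖ ≤ ε) ∧
      ‖Q * L * P - Matrix.diagonal d‖ ≤ ε := by
  have h1 : ‖Q * L * P - Matrix.diagonal d‖ ≤ ε / 3 + ε / 3 := by
    have : Q * L * P - Matrix.diagonal d =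
        Q * (L - L₀) * P + (Q * L₀ * P - Matrix.diagonal d) := by
      rw [Matrix.mul_sub, Matrix.sub_mul]
      abel
    rw [this]
    exact (norm_add_le _ _).trans
      (add_le_add ((norm_mul_mul_le hN hQ hP le_rfl).trans hL) hd)
  have h2 : ∀ x ∈ U, ‖Q * A x * P - Q * L * P‖ ≤ N ^ 2 * (C * Real.exp (-η' * x.re)) := by
    intro x hx
    rw [← Matrix.sub_mul, ← Matrix.mul_sub]
    exact norm_mul_mul_le hN hQ hP (hAL x hx)
  have h3 : ∀ x ∈ U, ‖Q * A x * P - Matrix.diagonal d‖ ≤ ε := by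
    intro x hx
    rw [← sub_add_sub_cancel _ (Q * L * P)]
    refine (norm_add_le _ _).trans ?_
    linarith [h2 x hx, hsmall x hx]
  refine ⟨⟨?_, fun x hx => (h3 x hx).trans hΓε, by linarith, fun x hx => ?_⟩, h3, by linarith⟩
  · exact (differentiableOn_matrix_mul hU (differentiableOn_matrix_mul hU
      (differentiableOn_const _) hA) (differentiableOn_const _)).sub_const _
  · rw [sub_sub_sub_cancel_right]
    refine (h2 x hx).trans ?_
    rw [← mul_assoc]
    have hΓ0 : 0 ≤ Γ := hε.trans hΓε
    have hx0 := hU0 x hx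
    gcongr

/-- The order of choices avoids circularity: the eigenvalues fix the slope `b` and the constant `c`,
hence `ε`; then come the similarities and `N`, then `M₁`, `Γ'` and the radii, and last `h₁`. -/
theorem exists_riccati_solution {m n p : ℕ} (hp : 1 ≤ p) {M β h₀ : ℝ} (hM : 0 ≤ M) (hβ : 0 < β)
    (hh₀ : 0 < h₀)
    {A₂ : ℝ → ℂ → Matrix (Fin n) (Fin n) ℂ} {A₁ : ℝ → ℂ → Matrix (Fin m) (Fin m) ℂ}
    {L₂ : ℝ → Matrix (Fin n) (Fin n) ℂ} {L₁ : ℝ → Matrix (Fin m) (Fin m) ℂ}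
    {B₂ : ℝ → ℂ → Matrix (Fin n) (Fin n) ℂ} {B₁ : ℝ → ℂ → Matrix (Fin m) (Fin m) ℂ}
    {G : ℝ → ℂ → Matrix (Fin n) (Fin m) ℂ} {K : ℝ → ℂ → Matrix (Fin m) (Fin n) ℂ}
    {B₂' : ℝ → Matrix (Fin n) (Fin n) ℂ} {B₁' : ℝ → Matrix (Fin m) (Fin m) ℂ}
    {G' : ℝ → Matrix (Fin n) (Fin m) ℂ} {K' : ℝ → Matrix (Fin m) (Fin n) ℂ}
    {C η η' Γ : ℝ} (hC : 0 ≤ C) (hη : 0 ≤ η) (hη' : 0 < η') (hηη' : η ≤ η') (hΓ : 0 ≤ Γ)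
    (hA₂ : ∀ h ∈ Ioc 0 h₀, DifferentiableOn ℂ (A₂ h) (openWedge M β))
    (hA₁ : ∀ h ∈ Ioc 0 h₀, DifferentiableOn ℂ (A₁ h) (openWedge M β))
    (hL₂ : ∀ h ∈ Ioc 0 h₀, ∀ x ∈ openWedge M β, ‖A₂ h x - L₂ h‖ ≤ C * Real.exp (-η' * x.re))
    (hL₁ : ∀ h ∈ Ioc 0 h₀, ∀ x ∈ openWedge M β, ‖A₁ h x - L₁ h‖ ≤ C * Real.exp (-η' * x.re))
    (hc₂ : ContinuousWithinAt L₂ (Ici 0) 0) (hc₁ : ContinuousWithinAt L₁ (Ici 0) 0)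
    (hsep : Disjoint (spectrum ℂ (L₂ 0)) (spectrum ℂ (L₁ 0)))
    (hG : ∀ h ∈ Ioc 0 h₀, ConvergesOn (openWedge M β) Γ η (G h) (G' h))
    (hB₂ : ∀ h ∈ Ioc 0 h₀, ConvergesOn (openWedge M β) Γ η (B₂ h) (B₂' h))
    (hB₁ : ∀ h ∈ Ioc 0 h₀, ConvergesOn (openWedge M β) Γ η (B₁ h) (B₁' h))
    (hK : ∀ h ∈ Ioc 0 h₀, ConvergesOn (openWedge M β) Γ η (K h) (K' h)) :
    ∃ M₁ β₁ h₁ R : ℝ, M ≤ M₁ ∧ 0 < β₁ ∧ β₁ ≤ β ∧ 0 < h₁ ∧ h₁ ≤ h₀ ∧ 0 ≤ R ∧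
      ∀ h ∈ Ioc 0 h₁, ∃ (y : ℂ → Matrix (Fin n) (Fin m) ℂ) (a : Matrix (Fin n) (Fin m) ℂ),
        (∀ x ∈ openWedge M₁ β₁, HasDerivAt y ((h : ℂ)⁻¹ • riccati ((h ^ p : ℝ) : ℂ) (A₂ h x) (A₁ h x)
          (G h x) (B₂ h x) (B₁ h x) (K h x) (y x)) x) ∧
        ‖a‖ ≤ R ∧ (G' h = 0 → a = 0) ∧
        ∀ x ∈ openWedge M₁ β₁, ‖y x - a‖ ≤ R * Real.exp (-η * x.re) := by
  obtain ⟨d₂, hd₂, H₂⟩ := exists_similar_near_diagonal (L₂ 0)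
  obtain ⟨d₁, hd₁, H₁⟩ := exists_similar_near_diagonal (L₁ 0)
  have hd : ∀ i j, d₂ i ≠ d₁ j := fun i j h =>
    Set.disjoint_left.1 hsep (hd₂ i) (h ▸ hd₁ j)
  obtain ⟨b, ⟨hb0, hbβ⟩, hs⟩ : ∃ b ∈ Ioc 0 β, ∀ i j, (d₂ i - d₁ j).re < 0 →
      2 * (b * |(d₂ i - d₁ j).im|) ≤ -(d₂ i - d₁ j).re := by
    have h1 : ∀ᶠ b : ℝ in 𝓝[>] 0, ∀ i j, (d₂ i - d₁ j).re < 0 →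
        2 * (b * |(d₂ i - d₁ j).im|) ≤ -(d₂ i - d₁ j).re := by
      refine eventually_all.2 fun i => eventually_all.2 fun j => ?_
      by_cases hre : (d₂ i - d₁ j).re < 0
      · have : Tendsto (fun b : ℝ => 2 * (b * |(d₂ i - d₁ j).im|)) (𝓝 0) (𝓝 0) := by
          have : Continuous (fun b : ℝ => 2 * (b * |(d₂ i - d₁ j).im|)) := by fun_prop
          simpa using this.tendsto 0
        filter_upwards [(this.mono_left nhdsWithin_le_nhds).eventually_le_const
          (neg_pos.2 hre)] with b hb _ using hb
      · exact .of_forall fun b h => absurd h hre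
    obtain ⟨b, hb1, hb2⟩ := (h1.and (Ioc_mem_nhdsGT hβ)).exists
    exact ⟨b, hb2, hb1⟩
  obtain ⟨c, hc, H⟩ := exists_riccati_solution_of_near_diagonal hb0 hd hs
  -- `2 * ε` is half of the admissible `1 / (2 * c)`; the rest absorbs the terms vanishing with `h`.
  -- Each `ε / 3` below pays for one error: similarity, `L h - L 0`, and `A - L`.
  set ε : ℝ := 1 / (8 * c) with hε
  have hε0 : 0 < ε := by positivity
  obtain ⟨P₂, Q₂, hPQ₂, -, hPd₂⟩ := H₂ (ε / 3) (by positivity)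
  obtain ⟨P₁, Q₁, hPQ₁, -, hPd₁⟩ := H₁ (ε / 3) (by positivity)
  set N : ℝ := ‖P₁‖ + ‖Q₁‖ + ‖P₂‖ + ‖Q₂‖ with hN
  have hP₁N : ‖P₁‖ ≤ N := by linarith [norm_nonneg Q₁, norm_nonneg P₂, norm_nonneg Q₂]
  have hQ₁N : ‖Q₁‖ ≤ N := by linarith [norm_nonneg P₁, norm_nonneg P₂, norm_nonneg Q₂]
  have hP₂N : ‖P₂‖ ≤ N := by linarith [norm_nonneg P₁, norm_nonneg Q₁, norm_nonneg Q₂]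
  have hQ₂N : ‖Q₂‖ ≤ N := by linarith [norm_nonneg P₁, norm_nonneg Q₁, norm_nonneg P₂]
  have hN0 : 0 ≤ N := (norm_nonneg _).trans hP₁N
  obtain ⟨M₁, hM₁, hMM₁⟩ : ∃ M₁, N ^ 2 * (C * Real.exp (-η' * M₁)) ≤ ε / 3 ∧ M ≤ M₁ := by
    have : Tendsto (fun t : ℝ => N ^ 2 * (C * Real.exp (-(η' * t)))) atTop (𝓝 0) := by
      simpa using ((Real.tendsto_exp_neg_atTop_nhds_zero.comp
        (tendsto_id.const_mul_atTop hη')).const_mul C).const_mul (N ^ 2)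
    obtain ⟨t, h1, h2⟩ := ((this.eventually_le_const (by positivity : 0 < ε / 3)).and
      (eventually_ge_atTop M)).exists
    exact ⟨t, by simpa using h1, h2⟩
  have hsub : openWedge M₁ b ⊆ openWedge M β := openWedge_mono hMM₁ hbβ hβ.le
  have hU0 : ∀ x ∈ openWedge M₁ b, 0 ≤ x.re := fun x hx => (hM.trans hMM₁).trans hx.1.le
  have hO := isOpen_openWedge M₁ b
  have hexpM : ∀ x ∈ openWedge M₁ b, N ^ 2 * (C * Real.exp (-η' * x.re)) ≤ ε / 3 := fun x hx => by
    refine le_trans ?_ hM₁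
    have : -η' * x.re ≤ -η' * M₁ := by nlinarith [hx.1]
    exact mul_le_mul_of_nonneg_left (mul_le_mul_of_nonneg_left (Real.exp_le_exp.2 this) hC)
      (by positivity)
  set Γ' : ℝ := N ^ 2 * Γ + N ^ 2 * C + ε with hΓ'
  have hΓ'0 : 0 ≤ Γ' := by positivity
  have hΓ1 : N ^ 2 * Γ ≤ Γ' := by
    have : 0 ≤ N ^ 2 * C := by positivity
    linarith
  have hΓ2 : N ^ 2 * C ≤ Γ' := by
    have : 0 ≤ N ^ 2 * Γ := by positivity
    linarith
  have hΓ3 : ε ≤ Γ' := by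
    have : 0 ≤ N ^ 2 * Γ := by positivity
    have : 0 ≤ N ^ 2 * C := by positivity
    linarith
  obtain ⟨Ra, Rv, hRa, hRv, H⟩ := H Γ' hΓ'0
  have hLsmall : ∀ {k : ℕ} {L : ℝ → Matrix (Fin k) (Fin k) ℂ}, ContinuousWithinAt L (Ici 0) 0 →
      ∀ᶠ h in 𝓝[>] (0 : ℝ), N ^ 2 * ‖L h - L 0‖ ≤ ε / 3 := by
    intro k L hL
    have h1 : Tendsto L (𝓝[>] 0) (𝓝 (L 0)) := hL.tendsto.mono_left (nhdsWithin_mono _ Ioi_subset_Ici_self)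
    have h2 : Tendsto (fun h => N ^ 2 * ‖L h - L 0‖) (𝓝[>] 0) (𝓝 0) := by
      simpa using ((h1.sub_const (L 0)).norm.const_mul (N ^ 2))
    exact h2.eventually_le_const (by positivity)
  have hsmall : ∀ᶠ h : ℝ in 𝓝[>] (0 : ℝ),
      2 * ε + h * (2 * Γ' + 2 * Γ' * (Ra + Rv)) + h * η ≤ 1 / (2 * c) := by
    have h1 : Continuous fun h : ℝ => 2 * ε + h * (2 * Γ' + 2 * Γ' * (Ra + Rv)) + h * η := by fun_prop
    refine ((h1.tendsto 0).mono_left nhdsWithin_le_nhds).eventually_le_const ?_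
    rw [zero_mul, zero_mul, add_zero, add_zero, hε]
    rw [mul_one_div, div_lt_div_iff₀ (by positivity) (by positivity)]
    linarith
  have hIoc : ∀ {r : ℝ}, 0 < r → ∀ᶠ h in 𝓝[>] (0 : ℝ), h ∈ Ioc 0 r := fun hr => Ioc_mem_nhdsGT hr
  obtain ⟨h₁, hh₁, hh₁sub⟩ := mem_nhdsGT_iff_exists_Ioc_subset.1
    ((hLsmall hc₂).and ((hLsmall hc₁).and (hsmall.and
      ((hIoc hh₀).and (hIoc one_pos)))))
  refine ⟨M₁, b, h₁, N ^ 2 * (Ra + Rv), hMM₁, hb0, hbβ, hh₁, (hh₁sub ⟨hh₁, le_rfl⟩).2.2.2.1.2,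
    by positivity, fun h hh => ?_⟩
  obtain ⟨hl₂, hl₁, hsm, hhh₀, hh1⟩ := hh₁sub hh
  -- Here `p ≥ 1` enters: the terms carrying `s = h ^ p` become small with `h`.
  have hpow : h ^ p ≤ h := pow_le_of_le_one hh.1.le hh1.2 (by omega)
  obtain ⟨c₂, e₂, e₂'⟩ := convergesOn_conj_sub_diagonal hO ((hA₂ h hhh₀).mono hsub) hN0 hQ₂N hP₂N
    hPd₂ hl₂ hηη' hU0 hexpM (fun x hx => hL₂ h hhh₀ x (hsub hx)) hε0.le hΓ3 hΓ2
  obtain ⟨c₁, e₁, e₁'⟩ := convergesOn_conj_sub_diagonal hO ((hA₁ h hhh₀).mono hsub) hN0 hQ₁N hP₁N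
    hPd₁ hl₁ hηη' hU0 hexpM (fun x hx => hL₁ h hhh₀ x (hsub hx)) hε0.le hΓ3 hΓ2
  obtain ⟨y, a, h1, h2, h3, h4⟩ := H M₁ h η ε (h ^ p) (hM.trans hMM₁) hh.1 hη (by positivity [hh.1])
    (hpow.trans hh1.2) (by
      refine le_trans ?_ hsm
      gcongr)
    _ _ _ _ _ _ _ _ _ _ _ _ c₂ c₁
    (((hG h hhh₀).mono hsub le_rfl).conj hO hN0 hQ₂N hP₁N |>.mono le_rfl hΓ1)
    (((hB₂ h hhh₀).mono hsub le_rfl).conj hO hN0 hQ₂N hP₂N |>.mono le_rfl hΓ1)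
    (((hB₁ h hhh₀).mono hsub le_rfl).conj hO hN0 hQ₁N hP₁N |>.mono le_rfl hΓ1)
    (((hK h hhh₀).mono hsub le_rfl).conj hO hN0 hQ₁N hP₂N |>.mono le_rfl hΓ1)
    e₂ e₂' e₁ e₁'
  refine ⟨fun x => P₂ * y x * Q₁, P₂ * a * Q₁, fun x hx => ?_, ?_, fun hG' => ?_, fun x hx => ?_⟩
  · refine (hasDerivAt_matrix_mul_mul P₂ Q₁ (h1 x hx)).congr_deriv ?_
    rw [Matrix.mul_smul, Matrix.smul_mul, riccati_conj hPQ₁ hPQ₂]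
  · refine (norm_mul_mul_le hN0 hP₂N hQ₁N h2).trans ?_
    gcongr
    linarith
  · rw [h3 (by simp [hG']), Matrix.mul_zero, Matrix.zero_mul]
  · rw [← Matrix.sub_mul, ← Matrix.mul_sub]
    refine (norm_mul_mul_le hN0 hP₂N hQ₁N (h4 x hx)).trans ?_
    rw [← mul_assoc]
    gcongr
    linarith

/-! ### Block matrices and construction of the conjugator -/

/-- The norm is a maximum of row sums: repeated rows are harmless, repeated columns are not, so only
`g` must be injective. -/
theorem norm_submatrix_le {ι κ ι' κ' : Type*} [Fintype ι] [Fintype κ] [Fintype ι'] [Fintype κ']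
    (A : Matrix ι κ ℂ) (f : ι' → ι) {g : κ' → κ} (hg : Function.Injective g) :
    ‖A.submatrix f g‖ ≤ ‖A‖ := by
  classical
  rw [← coe_nnnorm, ← coe_nnnorm, Matrix.linfty_opNNNorm_def, Matrix.linfty_opNNNorm_def]
  norm_cast
  refine Finset.sup_le fun i _ => ?_
  refine le_trans ?_ (Finset.le_sup (f := fun i => ∑ j, ‖A i j‖₊) (Finset.mem_univ (f i)))
  simp only [Matrix.submatrix_apply]
  rw [← Finset.sum_image (s := Finset.univ) (g := g) (f := fun j => ‖A (f i) j‖₊) hg.injOn]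
  exact Finset.sum_le_sum_of_subset (Finset.subset_univ _)

theorem norm_fromBlocks_le {m n : ℕ} (A : Matrix (Fin m) (Fin m) ℂ) (B : Matrix (Fin m) (Fin n) ℂ)
    (C : Matrix (Fin n) (Fin m) ℂ) (D : Matrix (Fin n) (Fin n) ℂ) :
    ‖Matrix.fromBlocks A B C D‖ ≤ ‖A‖ + ‖B‖ + (‖C‖ + ‖D‖) := by
  have hrow : ∀ {k l : ℕ} (X : Matrix (Fin k) (Fin l) ℂ) (i : Fin k), ∑ j, ‖X i j‖₊ ≤ ‖X‖₊ := by
    intro k l X i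
    rw [Matrix.linfty_opNNNorm_def]
    exact Finset.le_sup (f := fun i => ∑ j, ‖X i j‖₊) (Finset.mem_univ i)
  simp only [← coe_nnnorm]
  norm_cast
  rw [Matrix.linfty_opNNNorm_def]
  refine Finset.sup_le fun i _ => ?_
  rw [Fintype.sum_sum_type]
  rcases i with i | i
  · exact (add_le_add (hrow A i) (hrow B i)).trans le_self_add
  · exact (add_le_add (hrow C i) (hrow D i)).trans le_add_self

theorem ConvergesOn.submatrix {m n : ℕ} {ι κ : Type*} [Fintype ι] [Fintype κ] {U : Set ℂ}
    (hU : IsOpen U) {Γ η : ℝ}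
    {F : ℂ → Matrix ι κ ℂ} {L : Matrix ι κ ℂ} (hF : DifferentiableOn ℂ F U)
    (hΓ : ∀ x ∈ U, ‖F x‖ ≤ Γ) (hL : ‖L‖ ≤ Γ)
    (hFL : ∀ x ∈ U, ‖F x - L‖ ≤ Γ * Real.exp (-η * x.re))
    (f : Fin m → ι) {g : Fin n → κ} (hg : Function.Injective g) :
    ConvergesOn U Γ η (fun x => (F x).submatrix f g) (L.submatrix f g) :=
  ⟨(differentiableOn_matrix_iff hU).2 fun i j =>
      (differentiableOn_matrix_iff hU).1 hF (f i) (g j),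
    fun x hx => (norm_submatrix_le _ _ hg).trans (hΓ x hx), (norm_submatrix_le _ _ hg).trans hL,
    fun x hx => (norm_submatrix_le (F x - L) f hg).trans (hFL x hx)⟩

theorem hasDerivAt_fromBlocks {m n : ℕ} {A : ℂ → Matrix (Fin m) (Fin m) ℂ}
    {B : ℂ → Matrix (Fin m) (Fin n) ℂ} {C : ℂ → Matrix (Fin n) (Fin m) ℂ}
    {D : ℂ → Matrix (Fin n) (Fin n) ℂ} {A' : Matrix (Fin m) (Fin m) ℂ}
    {B' : Matrix (Fin m) (Fin n) ℂ} {C' : Matrix (Fin n) (Fin m) ℂ} {D' : Matrix (Fin n) (Fin n) ℂ}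
    {x : ℂ} (hA : HasDerivAt A A' x) (hB : HasDerivAt B B' x) (hC : HasDerivAt C C' x)
    (hD : HasDerivAt D D' x) :
    HasDerivAt (fun x => Matrix.fromBlocks (A x) (B x) (C x) (D x))
      (Matrix.fromBlocks A' B' C' D') x := by
  refine hasDerivAt_matrix_iff.2 fun i j => ?_
  rcases i with i | i <;> rcases j with j | j
  · exact hasDerivAt_matrix_iff.1 hA i j
  · exact hasDerivAt_matrix_iff.1 hB i j
  · exact hasDerivAt_matrix_iff.1 hC i j
  · exact hasDerivAt_matrix_iff.1 hD i j

theorem isUnit_of_norm_sub_one_lt {ι : Type*} [Fintype ι] [DecidableEq ι] {T : Matrix ι ι ℂ}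
    (h : ‖T - 1‖ < 1) : IsUnit T := by
  have h' : ‖1 - T‖ < 1 := by rwa [norm_sub_rev]
  have := (Units.oneSub (1 - T) h').isUnit
  rwa [Units.val_oneSub, sub_sub_cancel] at this

/-- Solutions of the two Riccati equations give a block-diagonalizing conjugator. -/
theorem isBlockDiagConjugator_of_riccati {m n p : ℕ} {h : ℝ} (hh : 0 < h) {U : Set ℂ}
    (hU : IsOpen U)
    {A₁₁ : ℝ → ℂ → Matrix (Fin m) (Fin m) ℂ} {A₂₂ : ℝ → ℂ → Matrix (Fin n) (Fin n) ℂ}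
    {Θ : ℝ → ℂ → Matrix (Fin m ⊕ Fin n) (Fin m ⊕ Fin n) ℂ}
    (hA₁₁ : DifferentiableOn ℂ (A₁₁ h) U) (hA₂₂ : DifferentiableOn ℂ (A₂₂ h) U)
    (hΘ : DifferentiableOn ℂ (Θ h) U)
    {X : ℂ → Matrix (Fin m) (Fin n) ℂ} {Y : ℂ → Matrix (Fin n) (Fin m) ℂ}
    (hY : ∀ x ∈ U, HasDerivAt Y ((h : ℂ)⁻¹ • riccati ((h ^ p : ℝ) : ℂ) (A₂₂ h x) (A₁₁ h x)
      (Θ h x).toBlocks₂₁ (Θ h x).toBlocks₂₂ (Θ h x).toBlocks₁₁ (Θ h x).toBlocks₁₂ (Y x)) x)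
    (hX : ∀ x ∈ U, HasDerivAt X ((h : ℂ)⁻¹ • riccati ((h ^ p : ℝ) : ℂ) (A₁₁ h x) (A₂₂ h x)
      (Θ h x).toBlocks₁₂ (Θ h x).toBlocks₁₁ (Θ h x).toBlocks₂₂ (Θ h x).toBlocks₂₁ (X x)) x)
    (hunit : ∀ x ∈ U, IsUnit (Matrix.fromBlocks 1 (((h ^ p : ℝ) : ℂ) • X x)
      (((h ^ p : ℝ) : ℂ) • Y x) 1)) :
    IsBlockDiagConjugator h U (coeff p A₁₁ A₂₂ Θ h) (fun x => Matrix.fromBlocks 1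
      (((h ^ p : ℝ) : ℂ) • X x) (((h ^ p : ℝ) : ℂ) • Y x) 1) := by
  set s : ℂ := ((h ^ p : ℝ) : ℂ) with hs
  have hderiv : ∀ x ∈ U, HasDerivAt (fun x => Matrix.fromBlocks 1 (s • X x) (s • Y x) 1) _ x :=
    fun x hx => hasDerivAt_fromBlocks (hasDerivAt_const x 1) ((hX x hx).const_smul s)
      ((hY x hx).const_smul s) (hasDerivAt_const x 1)
  have hdX : DifferentiableOn ℂ X U := fun x hx => (hX x hx).differentiableAt.differentiableWithinAt
  have hdY : DifferentiableOn ℂ Y U := fun x hx => (hY x hx).differentiableAt.differentiableWithinAt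
  have hΘ' := (differentiableOn_matrix_iff hU).1 hΘ
  have h11 : DifferentiableOn ℂ (fun x => (Θ h x).toBlocks₁₁) U :=
    (differentiableOn_matrix_iff hU).2 fun i j => hΘ' (.inl i) (.inl j)
  have h12 : DifferentiableOn ℂ (fun x => (Θ h x).toBlocks₁₂) U :=
    (differentiableOn_matrix_iff hU).2 fun i j => hΘ' (.inl i) (.inr j)
  have h21 : DifferentiableOn ℂ (fun x => (Θ h x).toBlocks₂₁) U :=
    (differentiableOn_matrix_iff hU).2 fun i j => hΘ' (.inr i) (.inl j)
  have h22 : DifferentiableOn ℂ (fun x => (Θ h x).toBlocks₂₂) U :=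
    (differentiableOn_matrix_iff hU).2 fun i j => hΘ' (.inr i) (.inr j)
  -- `D₁` and `D₂` are forced by the diagonal blocks, as `T` has identities there; the off-diagonal
  -- blocks are then `s` times the Riccati equations.
  refine ⟨DifferentiableOn.analyticOnNhd (fun x hx =>
      (hderiv x hx).differentiableAt.differentiableWithinAt) hU, hunit,
    fun x => A₁₁ h x + s • (Θ h x).toBlocks₁₁ + s ^ 2 • ((Θ h x).toBlocks₁₂ * Y x),
    fun x => A₂₂ h x + s • (Θ h x).toBlocks₂₂ + s ^ 2 • ((Θ h x).toBlocks₂₁ * X x), ?_, ?_, ?_⟩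
  · exact DifferentiableOn.analyticOnNhd ((hA₁₁.add (h11.const_smul s)).add
      ((differentiableOn_matrix_mul hU h12 hdY).const_smul (s ^ 2))) hU
  · exact DifferentiableOn.analyticOnNhd ((hA₂₂.add (h22.const_smul s)).add
      ((differentiableOn_matrix_mul hU h21 hdX).const_smul (s ^ 2))) hU
  · intro x hx
    have hh' : (h : ℂ) ≠ 0 := by exact_mod_cast hh.ne'
    have hs' : (h : ℂ) ^ p = s := by rw [hs]; push_cast; rfl
    refine (congrArg (fun D => (h : ℂ) • D + _) (hderiv x hx).deriv).trans ?_
    simp only [coeff, hs']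
    generalize Θ h x = Z
    conv_rhs => rw [← Matrix.fromBlocks_toBlocks Z]
    simp only [Matrix.fromBlocks_smul, smul_comm s (h : ℂ)⁻¹, smul_inv_smul₀ hh']
    simp only [Matrix.fromBlocks_multiply, Matrix.fromBlocks_add, riccati, smul_zero,
      Matrix.one_mul, Matrix.mul_one, Matrix.mul_zero, add_zero, zero_add, Matrix.mul_add, Matrix.add_mul,
      Matrix.smul_mul, Matrix.mul_smul, smul_add, smul_sub, smul_smul, Matrix.mul_assoc]
    congr 1
    · simp only [← pow_two]
    · module
    · module
    · module

theorem exists_conjugator {m n p : ℕ} (hp : 1 ≤ p) {M β h₀ : ℝ} (hM : 0 ≤ M) (hβ : 0 < β)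
    (hh₀ : 0 < h₀)
    {A₁₁ : ℝ → ℂ → Matrix (Fin m) (Fin m) ℂ} {A₂₂ : ℝ → ℂ → Matrix (Fin n) (Fin n) ℂ}
    {Θ : ℝ → ℂ → Matrix (Fin m ⊕ Fin n) (Fin m ⊕ Fin n) ℂ}
    {L₁₁ : ℝ → Matrix (Fin m) (Fin m) ℂ} {L₂₂ : ℝ → Matrix (Fin n) (Fin n) ℂ}
    {Θinf : ℝ → Matrix (Fin m ⊕ Fin n) (Fin m ⊕ Fin n) ℂ}
    {C η η' Γ : ℝ} (hC : 0 ≤ C) (hη : 0 ≤ η) (hη' : 0 < η') (hηη' : η ≤ η') (hΓ : 0 ≤ Γ)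
    (hA₁₁ : ∀ h ∈ Ioc 0 h₀, DifferentiableOn ℂ (A₁₁ h) (openWedge M β))
    (hA₂₂ : ∀ h ∈ Ioc 0 h₀, DifferentiableOn ℂ (A₂₂ h) (openWedge M β))
    (hΘ : ∀ h ∈ Ioc 0 h₀, DifferentiableOn ℂ (Θ h) (openWedge M β))
    (hL₁₁ : ∀ h ∈ Ioc 0 h₀, ∀ x ∈ openWedge M β, ‖A₁₁ h x - L₁₁ h‖ ≤ C * Real.exp (-η' * x.re))
    (hL₂₂ : ∀ h ∈ Ioc 0 h₀, ∀ x ∈ openWedge M β, ‖A₂₂ h x - L₂₂ h‖ ≤ C * Real.exp (-η' * x.re))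
    (hΘΓ : ∀ h ∈ Ioc 0 h₀, ∀ x ∈ openWedge M β, ‖Θ h x‖ ≤ Γ)
    (hΘinfΓ : ∀ h ∈ Ioc 0 h₀, ‖Θinf h‖ ≤ Γ)
    (hΘL : ∀ h ∈ Ioc 0 h₀, ∀ x ∈ openWedge M β, ‖Θ h x - Θinf h‖ ≤ Γ * Real.exp (-η * x.re))
    (hc₁₁ : ContinuousWithinAt L₁₁ (Ici 0) 0) (hc₂₂ : ContinuousWithinAt L₂₂ (Ici 0) 0)
    (hsep : Disjoint (spectrum ℂ (L₁₁ 0)) (spectrum ℂ (L₂₂ 0))) :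
    ∃ M₁ β₁ h₁ R : ℝ, M ≤ M₁ ∧ 0 < β₁ ∧ β₁ ≤ β ∧ 0 < h₁ ∧ h₁ ≤ h₀ ∧
      ∀ h ∈ Ioc 0 h₁, ∃ (T : ℂ → Matrix (Fin m ⊕ Fin n) (Fin m ⊕ Fin n) ℂ)
        (Tinf : Matrix (Fin m ⊕ Fin n) (Fin m ⊕ Fin n) ℂ),
        IsBlockDiagConjugator h (openWedge M₁ β₁) (coeff p A₁₁ A₂₂ Θ h) T ∧
        (∀ x ∈ openWedge M₁ β₁, ‖T x - 1‖ < 1) ∧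
        (∀ x ∈ openWedge M₁ β₁, ‖T x - 1‖ ≤ R * h ^ p) ∧
        (∀ x ∈ openWedge M₁ β₁, ‖T x - Tinf‖ ≤ R * Real.exp (-η * x.re)) ∧
        (Θinf h = 0 → Tinf = 1) := by
  have hO := isOpen_openWedge M β
  have hconv : ∀ {k l : ℕ} (f : Fin k → Fin m ⊕ Fin n) {g : Fin l → Fin m ⊕ Fin n},
      Function.Injective g → ∀ h ∈ Ioc 0 h₀, ConvergesOn (openWedge M β) Γ η
        (fun x => (Θ h x).submatrix f g) ((Θinf h).submatrix f g) := fun f g hg h hh =>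
    ConvergesOn.submatrix hO (hΘ h hh) (hΘΓ h hh) (hΘinfΓ h hh) (hΘL h hh) f hg
  have hl : Function.Injective (Sum.inl : Fin m → Fin m ⊕ Fin n) := Sum.inl_injective
  have hr : Function.Injective (Sum.inr : Fin n → Fin m ⊕ Fin n) := Sum.inr_injective
  obtain ⟨M₂, β₂, h₂, R₂, hM₂, hβ₂, hββ₂, hh₂, hhh₂, hR₂, H₂⟩ := exists_riccati_solution hp hM hβ
    hh₀ hC hη hη' hηη' hΓ hA₂₂ hA₁₁ hL₂₂ hL₁₁ hc₂₂ hc₁₁ hsep.symm (hconv Sum.inr hl)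
    (hconv Sum.inr hr) (hconv Sum.inl hl) (hconv Sum.inl hr)
  obtain ⟨M₃, β₃, h₃, R₃, hM₃, hβ₃, hββ₃, hh₃, hhh₃, hR₃, H₃⟩ := exists_riccati_solution hp hM hβ
    hh₀ hC hη hη' hηη' hΓ hA₁₁ hA₂₂ hL₁₁ hL₂₂ hc₁₁ hc₂₂ hsep (hconv Sum.inl hr)
    (hconv Sum.inl hl) (hconv Sum.inr hr) (hconv Sum.inr hl)
  set R : ℝ := 2 * (R₂ + R₃) with hR
  have hR0 : 0 ≤ R := by positivity
  -- The cap `1 / (R + 1)` gives `h ≤ 1` and `R * h ^ p < 1`, so `T` is invertible by a Neumann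
  -- series.
  set h₁ : ℝ := min (min h₂ h₃) (1 / (R + 1)) with hh₁
  set U := openWedge (max M₂ M₃) (min β₂ β₃) with hU
  have hU₂ : U ⊆ openWedge M₂ β₂ := openWedge_mono (le_max_left _ _) (min_le_left _ _) hβ₂.le
  have hU₃ : U ⊆ openWedge M₃ β₃ := openWedge_mono (le_max_right _ _) (min_le_right _ _) hβ₃.le
  have hUM : U ⊆ openWedge M β := hU₂.trans (openWedge_mono hM₂ hββ₂ hβ.le)
  refine ⟨max M₂ M₃, min β₂ β₃, h₁, R, hM₂.trans (le_max_left _ _), lt_min hβ₂ hβ₃,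
    (min_le_left _ _).trans hββ₂, by positivity, (min_le_left _ _).trans ((min_le_left _ _).trans hhh₂),
    fun h hh => ?_⟩
  have hle₂ : h ≤ h₂ := hh.2.trans ((min_le_left _ _).trans (min_le_left _ _))
  have hle₃ : h ≤ h₃ := hh.2.trans ((min_le_left _ _).trans (min_le_right _ _))
  have hleR : h ≤ 1 / (R + 1) := hh.2.trans (min_le_right _ _)
  have hh0 : 0 < h := hh.1
  have hhh₀ : h ∈ Ioc 0 h₀ := ⟨hh0, hle₂.trans hhh₂⟩
  have hle1 : h ≤ 1 := hleR.trans (by rw [div_le_one (by positivity)]; linarith)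
  have hpow : h ^ p ≤ h := pow_le_of_le_one hh0.le hle1 (by omega)
  have hpow1 : h ^ p ≤ 1 := hpow.trans hle1
  have hpow0 : 0 ≤ h ^ p := by positivity
  have hRpow : R * h ^ p < 1 := by
    calc R * h ^ p ≤ R * (1 / (R + 1)) := by gcongr; exact hpow.trans hleR
      _ < 1 := by rw [mul_one_div, div_lt_one (by positivity)]; linarith
  obtain ⟨Y, c, hY, hc, hc0, hYc⟩ := H₂ h ⟨hh0, hle₂⟩
  obtain ⟨X, a, hX, ha, ha0, hXa⟩ := H₃ h ⟨hh0, hle₃⟩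
  have hexp : ∀ x ∈ U, Real.exp (-η * x.re) ≤ 1 := fun x hx => by
    have := (hUM hx).1
    rw [Real.exp_le_one_iff]
    nlinarith
  have hYn : ∀ x ∈ U, ‖Y x‖ ≤ 2 * R₂ := fun x hx => by
    have h1 := hYc x (hU₂ hx)
    have h2 : R₂ * Real.exp (-η * x.re) ≤ R₂ * 1 := by gcongr; exact hexp x hx
    have h3 := norm_add_le (Y x - c) c
    rw [sub_add_cancel] at h3
    linarith
  have hXn : ∀ x ∈ U, ‖X x‖ ≤ 2 * R₃ := fun x hx => by
    have h1 := hXa x (hU₃ hx)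
    have h2 : R₃ * Real.exp (-η * x.re) ≤ R₃ * 1 := by gcongr; exact hexp x hx
    have h3 := norm_add_le (X x - a) a
    rw [sub_add_cancel] at h3
    linarith
  set s : ℂ := ((h ^ p : ℝ) : ℂ) with hs
  have hsn : ‖s‖ = h ^ p := by rw [hs, Complex.norm_real, Real.norm_eq_abs, abs_of_nonneg hpow0]
  have hoff : ∀ (X X' : Matrix (Fin m) (Fin n) ℂ) (Y Y' : Matrix (Fin n) (Fin m) ℂ),
      ‖Matrix.fromBlocks 1 (s • X) (s • Y) 1 - Matrix.fromBlocks 1 (s • X') (s • Y') 1‖ ≤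
        h ^ p * (‖X - X'‖ + ‖Y - Y'‖) := by
    intro X X' Y Y'
    rw [sub_eq_add_neg, Matrix.fromBlocks_neg, Matrix.fromBlocks_add]
    refine (norm_fromBlocks_le _ _ _ _).trans_eq ?_
    rw [← sub_eq_add_neg, ← sub_eq_add_neg, ← sub_eq_add_neg, ← sub_eq_add_neg, sub_self, sub_self,
      ← smul_sub, ← smul_sub, norm_smul, norm_smul, hsn, norm_zero, norm_zero]
    ring
  have hone : Matrix.fromBlocks (1 : Matrix (Fin m) (Fin m) ℂ) (s • 0) (s • 0)
      (1 : Matrix (Fin n) (Fin n) ℂ) = 1 := by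
    rw [smul_zero, smul_zero, Matrix.fromBlocks_one]
  have hT1 : ∀ x ∈ U, ‖Matrix.fromBlocks 1 (s • X x) (s • Y x) 1 - 1‖ ≤ R * h ^ p := by
    intro x hx
    have h1 := hoff (X x) 0 (Y x) 0
    rw [hone, sub_zero, sub_zero] at h1
    refine h1.trans ?_
    rw [mul_comm]
    gcongr
    linarith [hXn x hx, hYn x hx]
  refine ⟨fun x => Matrix.fromBlocks 1 (s • X x) (s • Y x) 1,
    Matrix.fromBlocks 1 (s • a) (s • c) 1, ?_, fun x hx => (hT1 x hx).trans_lt hRpow, hT1,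
    fun x hx => ?_, fun h0 => ?_⟩
  · exact isBlockDiagConjugator_of_riccati hh0 (isOpen_openWedge _ _) ((hA₁₁ h hhh₀).mono hUM)
      ((hA₂₂ h hhh₀).mono hUM) ((hΘ h hhh₀).mono hUM) (fun x hx => hY x (hU₂ hx))
      (fun x hx => hX x (hU₃ hx))
      fun x hx => isUnit_of_norm_sub_one_lt ((hT1 x hx).trans_lt hRpow)
  · refine (hoff _ _ _ _).trans ?_
    have h1 := hYc x (hU₂ hx)
    have h2 := hXa x (hU₃ hx)
    have h3 := Real.exp_pos (-η * x.re)
    calc h ^ p * (‖X x - a‖ + ‖Y x - c‖) ≤ 1 * (‖X x - a‖ + ‖Y x - c‖) := by gcongr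
      _ ≤ (R₂ + R₃) * Real.exp (-η * x.re) := by linarith
      _ ≤ R * Real.exp (-η * x.re) := by
        gcongr
        linarith
  · rw [hc0 (by rw [h0]; rfl), ha0 (by rw [h0]; rfl), hone]

/-! ### Passage between closed and open wedges, and the main theorem -/

theorem openWedge_subset_wedge {M M' β : ℝ} (hM : M ≤ M') (hβ : 0 ≤ β) :
    openWedge M' β ⊆ wedge M β := by
  rintro x ⟨h1, h2⟩
  exact ⟨hM.trans h1.le, h2.le.trans (mul_le_mul_of_nonneg_left (by linarith) hβ)⟩

theorem wedge_subset_openWedge {M β : ℝ} (hβ : 0 < β) : wedge (M + 1) (β / 2) ⊆ openWedge M β := by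
  rintro x ⟨h1, h2⟩
  refine ⟨by linarith, h2.trans_lt ?_⟩
  nlinarith

theorem IsBlockDiagConjugator.mono {m n : ℕ} {h : ℝ} {S S' : Set ℂ}
    {G T : ℂ → Matrix (Fin m ⊕ Fin n) (Fin m ⊕ Fin n) ℂ} (H : IsBlockDiagConjugator h S G T)
    (hS : S' ⊆ S) : IsBlockDiagConjugator h S' G T := by
  obtain ⟨h1, h2, D₁, D₂, h3, h4, h5⟩ := H
  exact ⟨h1.mono hS, fun x hx => h2 x (hS hx), D₁, D₂, h3.mono hS, h4.mono hS,
    fun x hx => h5 x (hS hx)⟩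

/-- For `Re x ≥ 0` an exponential bound survives lowering the rate and raising the constant, so
several estimates can share both. This is why the vertex moves to `max M 0`. -/
theorem UniformExpConv.exists_nonneg {E : Type*} [NormedAddCommGroup E] {h₀ M β : ℝ}
    (hβ : 0 ≤ β) {F : ℝ → ℂ → E} {L : ℝ → E} (H : UniformExpConv h₀ (wedge M β) F L) :
    ∃ C η : ℝ, 0 ≤ C ∧ 0 < η ∧ ∀ C' η', C ≤ C' → η' ≤ η → ∀ h ∈ Ioc 0 h₀,
      ∀ x ∈ openWedge (max M 0) β, ‖F h x - L h‖ ≤ C' * Real.exp (-η' * x.re) := by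
  obtain ⟨C, η, hη, H⟩ := H
  refine ⟨|C|, η, abs_nonneg _, hη, fun C' η' hC hη' h hh x hx => ?_⟩
  refine (H h hh x (openWedge_subset_wedge (le_max_left _ _) hβ hx)).trans ?_
  have hx0 : 0 ≤ x.re := (le_max_right M 0).trans hx.1.le
  have : 0 ≤ C' := (abs_nonneg C).trans hC
  exact mul_le_mul ((le_abs_self C).trans hC) (Real.exp_le_exp.2 (by nlinarith))
    (Real.exp_nonneg _) this

/-- A uniformly bounded and exponentially convergent family has bounded limits. -/
theorem UniformExpConv.norm_limit_le {E : Type*} [NormedAddCommGroup E] {h₀ M β : ℝ}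
    {F : ℝ → ℂ → E} {L : ℝ → E} (H : UniformExpConv h₀ (wedge M β) F L)
    (hF : UniformBdd h₀ (wedge M β) F) :
    ∃ C : ℝ, 0 ≤ C ∧ ∀ h ∈ Ioc 0 h₀, ‖L h‖ ≤ C := by
  obtain ⟨C, η, -, H⟩ := H
  obtain ⟨B, hF⟩ := hF
  have hM : (M : ℂ) ∈ wedge M β := by simp [wedge]
  refine ⟨|B + C * Real.exp (-η * M)|, abs_nonneg _, fun h hh => le_trans ?_ (le_abs_self _)⟩
  have h1 := H h hh M hM
  have h2 := hF h hh M hM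
  have h3 := norm_sub_norm_le (L h) (F h M)
  rw [norm_sub_rev] at h3
  rw [Complex.ofReal_re] at h1
  linarith

end BlockDiag

theorem theorem1p3 (m n p : ℕ) (hp : 1 ≤ p) (M β h₀ : ℝ) (hβ : 0 < β) (hh₀ : 0 < h₀)
    (A₁₁ : ℝ → ℂ → Matrix (Fin m) (Fin m) ℂ) (A₂₂ : ℝ → ℂ → Matrix (Fin n) (Fin n) ℂ)
    (Θ : ℝ → ℂ → Matrix (Fin m ⊕ Fin n) (Fin m ⊕ Fin n) ℂ)
    (L₁₁ : ℝ → Matrix (Fin m) (Fin m) ℂ) (L₂₂ : ℝ → Matrix (Fin n) (Fin n) ℂ)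
    -- analyticity in `x` on the wedge, for every `h`
    (hA₁₁ : ∀ h ∈ Ioc 0 h₀, AnalyticOnNhd ℂ (A₁₁ h) (BlockDiag.wedge M β))
    (hA₂₂ : ∀ h ∈ Ioc 0 h₀, AnalyticOnNhd ℂ (A₂₂ h) (BlockDiag.wedge M β))
    (hΘ : ∀ h ∈ Ioc 0 h₀, AnalyticOnNhd ℂ (Θ h) (BlockDiag.wedge M β))
    -- exponential convergence to the limits at `+∞`, and boundedness, uniformly in `h`
    (hL₁₁ : BlockDiag.UniformExpConv h₀ (BlockDiag.wedge M β) A₁₁ L₁₁)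
    (hL₂₂ : BlockDiag.UniformExpConv h₀ (BlockDiag.wedge M β) A₂₂ L₂₂)
    (hΘbdd : BlockDiag.UniformBdd h₀ (BlockDiag.wedge M β) Θ)
    -- the limits are continuous in `h` at `h = 0`, where they have no common eigenvalue
    (hc₁₁ : ContinuousWithinAt L₁₁ (Ici 0) 0)
    (hc₂₂ : ContinuousWithinAt L₂₂ (Ici 0) 0)
    (hsep : Disjoint (spectrum ℂ (L₁₁ 0)) (spectrum ℂ (L₂₂ 0))) :
    ∃ M' β' h₁ : ℝ, M ≤ M' ∧ 0 < β' ∧ β' ≤ β ∧ 0 < h₁ ∧ h₁ ≤ h₀ ∧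
      ∃ T : ℝ → ℂ → Matrix (Fin m ⊕ Fin n) (Fin m ⊕ Fin n) ℂ,
        (∀ h ∈ Ioc 0 h₁,
          BlockDiag.IsBlockDiagConjugator h (BlockDiag.wedge M' β') (BlockDiag.coeff p A₁₁ A₂₂ Θ h) (T h)) ∧
        BlockDiag.UniformBdd h₁ (BlockDiag.wedge M' β') T ∧
        (∃ C : ℝ, ∀ h ∈ Ioc 0 h₁, ∀ x ∈ BlockDiag.wedge M' β', ‖T h x - 1‖ ≤ C * h ^ p) ∧
        ((∃ Θinf : ℝ → Matrix (Fin m ⊕ Fin n) (Fin m ⊕ Fin n) ℂ,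
            BlockDiag.UniformExpConv h₀ (BlockDiag.wedge M β) Θ Θinf) →
          ∃ Tinf : ℝ → Matrix (Fin m ⊕ Fin n) (Fin m ⊕ Fin n) ℂ,
            BlockDiag.UniformExpConv h₁ (BlockDiag.wedge M' β') T Tinf) ∧
        (BlockDiag.UniformExpConv h₀ (BlockDiag.wedge M β) Θ (fun _ => 0) →
          BlockDiag.UniformExpConv h₁ (BlockDiag.wedge M' β') T (fun _ => 1)) := by
  obtain ⟨C₁, η₁, hC₁, hη₁, H₁⟩ := hL₁₁.exists_nonneg hβ.le
  obtain ⟨C₂, η₂, hC₂, hη₂, H₂⟩ := hL₂₂.exists_nonneg hβ.le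
  obtain ⟨B, hB⟩ := id hΘbdd
  have hsub : BlockDiag.openWedge (max M 0) β ⊆ BlockDiag.wedge M β :=
    BlockDiag.openWedge_subset_wedge (le_max_left _ _) hβ.le
  -- One construction for all hypotheses on `Θ`, with `η = 0` allowed when no decay is known.
  have main : ∀ (Θinf : ℝ → Matrix (Fin m ⊕ Fin n) (Fin m ⊕ Fin n) ℂ) (η Γ : ℝ), 0 ≤ η →
      η ≤ min η₁ η₂ → |B| ≤ Γ → (∀ h ∈ Ioc 0 h₀, ‖Θinf h‖ ≤ Γ) →
      (∀ h ∈ Ioc 0 h₀, ∀ x ∈ BlockDiag.openWedge (max M 0) β,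
        ‖Θ h x - Θinf h‖ ≤ Γ * Real.exp (-η * x.re)) →
      ∃ M' β' h₁ : ℝ, M ≤ M' ∧ 0 < β' ∧ β' ≤ β ∧ 0 < h₁ ∧ h₁ ≤ h₀ ∧
        ∃ T Tinf, (∀ h ∈ Ioc 0 h₁, BlockDiag.IsBlockDiagConjugator h (BlockDiag.wedge M' β')
            (BlockDiag.coeff p A₁₁ A₂₂ Θ h) (T h)) ∧
          BlockDiag.UniformBdd h₁ (BlockDiag.wedge M' β') T ∧
          (∃ C : ℝ, ∀ h ∈ Ioc 0 h₁, ∀ x ∈ BlockDiag.wedge M' β', ‖T h x - 1‖ ≤ C * h ^ p) ∧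
          (0 < η → BlockDiag.UniformExpConv h₁ (BlockDiag.wedge M' β') T Tinf) ∧
          ∀ h ∈ Ioc 0 h₁, Θinf h = 0 → Tinf h = 1 := by
    intro Θinf η Γ hη hηle hΓ hΘinf hΘL
    obtain ⟨M₁, β₁, h₁, R, hM₁, hβ₁, hββ₁, hh₁, hhh₁, H⟩ := BlockDiag.exists_conjugator hp
      (le_max_right M 0) hβ hh₀ (C := max C₁ C₂) (hC₁.trans (le_max_left _ _)) hη
      (lt_min hη₁ hη₂) hηle ((abs_nonneg B).trans hΓ)
      (fun h hh => (hA₁₁ h hh).differentiableOn.mono hsub)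
      (fun h hh => (hA₂₂ h hh).differentiableOn.mono hsub)
      (fun h hh => (hΘ h hh).differentiableOn.mono hsub)
      (H₁ _ _ (le_max_left _ _) (min_le_left _ _)) (H₂ _ _ (le_max_right _ _) (min_le_right _ _))
      (fun h hh x hx => (hB h hh x (hsub hx)).trans ((le_abs_self B).trans hΓ)) hΘinf hΘL
      hc₁₁ hc₂₂ hsep
    choose! T Tinf hT using H
    have hS : BlockDiag.wedge (M₁ + 1) (β₁ / 2) ⊆ BlockDiag.openWedge M₁ β₁ :=
      BlockDiag.wedge_subset_openWedge hβ₁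
    refine ⟨M₁ + 1, β₁ / 2, h₁, by linarith [le_max_left M 0], by positivity, by linarith, hh₁,
      hhh₁, T, Tinf, fun h hh => (hT h hh).1.mono hS,
      ⟨1 + ‖(1 : Matrix (Fin m ⊕ Fin n) (Fin m ⊕ Fin n) ℂ)‖, fun h hh x hx => ?_⟩,
      ⟨R, fun h hh x hx => (hT h hh).2.2.1 x (hS hx)⟩,
      fun hη => ⟨R, η, hη, fun h hh x hx => (hT h hh).2.2.2.1 x (hS hx)⟩,
      fun h hh => (hT h hh).2.2.2.2⟩
    have h1 := (hT h hh).2.1 x (hS hx)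
    have h2 := norm_add_le (T h x - 1) 1
    rw [sub_add_cancel] at h2
    linarith
  -- `T` and the wedge precede the two implications, so the behaviour of `Θ` is decided first. If
  -- `Θ` decays to zero, a single `T` serves both implications, its limit being `1`.
  by_cases h4 : BlockDiag.UniformExpConv h₀ (BlockDiag.wedge M β) Θ (fun _ => 0)
  · obtain ⟨C, η, hC, hη, H⟩ := h4.exists_nonneg hβ.le
    have hηpos : 0 < min η (min η₁ η₂) := lt_min hη (lt_min hη₁ hη₂)
    obtain ⟨M', β', h₁, a1, a2, a3, a4, a5, T, Tinf, b1, b2, b3, b4, b5⟩ := main (fun _ => 0)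
      (min η (min η₁ η₂)) (max C |B|) hηpos.le (min_le_right _ _) (le_max_right _ _)
      (fun h hh => by rw [norm_zero]; exact hC.trans (le_max_left _ _))
      (H _ _ (le_max_left _ _) (min_le_left _ _))
    refine ⟨M', β', h₁, a1, a2, a3, a4, a5, T, b1, b2, b3, fun _ => ⟨Tinf, b4 hηpos⟩, fun _ => ?_⟩
    obtain ⟨C', η', hη', H'⟩ := b4 hηpos
    refine ⟨C', η', hη', fun h hh x hx => ?_⟩
    rw [← b5 h hh rfl]
    exact H' h hh x hx
  by_cases h3 : ∃ Θinf, BlockDiag.UniformExpConv h₀ (BlockDiag.wedge M β) Θ Θinf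
  · obtain ⟨Θinf, h3⟩ := h3
    obtain ⟨C, η, hC, hη, H⟩ := h3.exists_nonneg hβ.le
    obtain ⟨B', hB', HB'⟩ := h3.norm_limit_le hΘbdd
    have hηpos : 0 < min η (min η₁ η₂) := lt_min hη (lt_min hη₁ hη₂)
    obtain ⟨M', β', h₁, a1, a2, a3, a4, a5, T, Tinf, b1, b2, b3, b4, b5⟩ := main Θinf
      (min η (min η₁ η₂)) (C + |B| + B') hηpos.le (min_le_right _ _)
      (by linarith) (fun h hh => (HB' h hh).trans (by linarith [abs_nonneg B]))
      (H _ _ (by linarith [abs_nonneg B]) (min_le_left _ _))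
    exact ⟨M', β', h₁, a1, a2, a3, a4, a5, T, b1, b2, b3, fun _ => ⟨Tinf, b4 hηpos⟩,
      fun h => absurd h h4⟩
  -- Without convergence, rate `0` and limit `0` turn the convergence requirement into the bound on
  -- `Θ`.
  · obtain ⟨M', β', h₁, a1, a2, a3, a4, a5, T, Tinf, b1, b2, b3, -, -⟩ := main (fun _ => 0) 0 |B|
      le_rfl (le_min hη₁.le hη₂.le) le_rfl (fun h hh => by rw [norm_zero]; exact abs_nonneg B)
      (fun h hh x hx => by
        simpa using (hB h hh x (hsub hx)).trans (le_abs_self B))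
    exact ⟨M', β', h₁, a1, a2, a3, a4, a5, T, b1, b2, b3, fun h => absurd h h3,
      fun h => absurd h h4⟩
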